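/- **Setting (0. Permutations).** Let $\mathfrak S_n$ be the set of permutations $\sigma=\sigma_1\cdots\sigma_n$ of $[n]=\{1,\dots,n\}$, with the weak order: $\sigma\le\tau$ iff $\mathrm{inv}(\sigma)\subseteq\mathrm{inv}(\tau)$, where $\mathrm{inv}(\sigma)=\{(\sigma_i,\sigma_j) : i<j,\ \sigma_i>\sigma_j\}$. It is a lattice. For $\sigma\in\mathfrak S_m$, $\tau\in\mathfrak S_n$ let $\sigma\backslash\tau=\sigma_1\cdots\sigma_m(m+\tau_1)\cdots(m+\tau_n)$ and $\tau/\sigma=(m+\tau_1)\cdots(m+\tau_n)\sigma_1\cdots\sigma_m$ in $\mathfrak S_{m+n}$. The shifted shuffle of $\sigma$ and $\tau$ is the set of $\rho\in\mathfrak S_{m+n}$ whose subword on the values $[m]$ is $\sigma$ and whose subword on the values $[m+n]\setminus[m]$ standardizes to $\tau$. **1. Arcs.** An arc is $(a,b,n,S)$ with $1\le a<b\le n$ and $S\subseteq\,]a,b[\,=\{a+1,\dots,b-1\}$. Arcs $(a,b,n,R)$ and $(c,d,n,S)$ cross if there are $r,s\in([a,b]\cap[c,d])\setminus(\{a,b\}\cap\{c,d\})$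 with $r\in(R\cup\{a,b\})\setminus S$ and $s\in(S\cup\{c,d\})\setminus R$. A noncrossing arc diagram is a set of arcs (same $n$) any two distinct ones of which do not cross and have distinct left endpoints and distinct right endpoints. For $\sigma\in\mathfrak S_n$, let $\underline\delta(\sigma)$ be the set of arcs $(\sigma_{i+1},\sigma_i,n,\{\sigma_j : j<i,\ \sigma_{i+1}<\sigma_j<\sigma_i\})$ over all descents $\sigma_i>\sigma_{i+1}$. **2. Arc ideals and congruences.** An arc ideal is a set $\mathcal I$ of arcs with given $n$ such that $(a,d,n,S)\in\mathcal I$ implies $(b,c,n,S\cap\,]b,c[)\in\mathcal I$ for all $a\le b<c\le d$. For an arc ideal $\mathcal I$, let $\equiv_{\mathcal I}$ be the (unique) lattice congruence of the weak order on $\mathfrak S_n$ such that $\mathcal I$ is the set of arcs $\alpha$ with $\underline\delta(\sigma)=\{\alpha\}$ for some join-irreducible $\sigma$ that is the bottom of its class. Put $\underline\eta_{\mathcal I}(\sigma)=\underline\delta(\pi_\downarrow(\sigma))$, where $\pi_\downarrow(\sigma)$ is the bottom of the $\equiv_{\mathcal I}$-class of $\sigma$. The map $\underline\eta_{\mathcal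 I}$ identifies the classes with the noncrossing arc diagrams contained in $\mathcal I$; the latter are ordered as the lattice quotient: $\mathcal D\le\mathcal E$ iff there are $\sigma\le\tau$ with $\underline\eta_{\mathcal I}(\sigma)=\mathcal D$ and $\underline\eta_{\mathcal I}(\tau)=\mathcal E$. **3. Decorations.** A decoration set is a graded set $\mathfrak X=\bigsqcup_{n\ge0}\mathfrak X_n$ with a concatenation $\mathfrak X_m\times\mathfrak X_n\to\mathfrak X_{m+n}$, $(\mathcal X,\mathcal Y)\mapsto\mathcal X\mathcal Y$, and a selection $\mathfrak X_m\times\binom{[m]}{k}\to\mathfrak X_k$, $(\mathcal X,R)\mapsto\mathcal X|_R$, such that concatenation is associative, $(\mathcal X|_R)|_S=\mathcal X|_{\{r_s : s\in S\}}$ for $R=\{r_1<\dots<r_q\}$ and $S\subseteq[q]$, and $\mathcal X|_R\,\mathcal Y|_S=(\mathcal X\mathcal Y)|_{R\cup(S+m)}$ for $\mathcal X\in\mathfrak X_m$, $\mathcal Y\in\mathfrak X_n$, $R\subseteq[m]$, $S\subseteq[n]$. Fix a conservative function, that is, a map $\mathrm{arcs}$ sending each $\mathcal X\in\mathfrak X_n$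 to an arc ideal of arcs of size $n$, such that (i) for $\mathcal X\in\mathfrak X_m$ and $\mathcal Y\in\mathfrak X_n$, $(a,b,m,S)\in\mathrm{arcs}(\mathcal X)$ implies $(a,b,m+n,S)\in\mathrm{arcs}(\mathcal X\mathcal Y)$, and $(a,b,n,S)\in\mathrm{arcs}(\mathcal Y)$ implies $(a+m,b+m,m+n,S+m)\in\mathrm{arcs}(\mathcal X\mathcal Y)$; (ii) for $\mathcal Z\in\mathfrak X_p$, $R=\{r_1<\dots<r_q\}\subseteq[p]$, $1\le a<b\le q$ and $S\subseteq\,]r_a,r_b[$, $(r_a,r_b,p,S)\in\mathrm{arcs}(\mathcal Z)$ implies $(a,b,q,\{c\in[q] : r_c\in S\})\in\mathrm{arcs}(\mathcal Z|_R)$. **4. The algebra.** Over a field $\mathbf k$, consider the vector space with basis $\mathbb F_{(\sigma,\mathcal X)}$, for $n\ge0$, $\sigma\in\mathfrak S_n$, $\mathcal X\in\mathfrak X_n$, with the bilinear product $\mathbb F_{(\sigma,\mathcal X)}\cdot\mathbb F_{(\tau,\mathcal Y)}=\sum_\rho\mathbb F_{(\rho,\mathcal X\mathcal Y)}$, where $\rho$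 ranges over the shifted shuffle of $\sigma$ and $\tau$. For $\mathcal X\in\mathfrak X_n$ and a noncrossing arc diagram $\mathcal D\subseteq\mathrm{arcs}(\mathcal X)$ put $$\mathbb P_{(\mathcal D,\mathcal X)}=\sum_{\sigma\in\mathfrak S_n,\ \underline\eta_{\mathrm{arcs}(\mathcal X)}(\sigma)=\mathcal D}\mathbb F_{(\sigma,\mathcal X)}.$$ **Proposition.** Let $\mathcal X\in\mathfrak X_m$, $\mathcal Y\in\mathfrak X_n$, and let $\mathcal D\subseteq\mathrm{arcs}(\mathcal X)$ and $\mathcal E\subseteq\mathrm{arcs}(\mathcal Y)$ be noncrossing arc diagrams. Then $\underline\eta_{\mathrm{arcs}(\mathcal X)}^{-1}(\mathcal D)=[\mu,\nu]$ and $\underline\eta_{\mathrm{arcs}(\mathcal Y)}^{-1}(\mathcal E)=[\lambda,\omega]$ are nonempty intervals of the weak orders on $\mathfrak S_m$ and $\mathfrak S_n$, and $$\mathbb P_{(\mathcal D,\mathcal X)}\cdot\mathbb P_{(\mathcal E,\mathcal Y)}=\sum_{\mathcal F}\mathbb P_{(\mathcal F,\mathcal X\mathcal Y)},$$ where $\mathcal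 F$ ranges over the interval between $\underline\eta_{\mathrm{arcs}(\mathcal X\mathcal Y)}(\mu\backslash\lambda)$ and $\underline\eta_{\mathrm{arcs}(\mathcal X\mathcal Y)}(\omega/\nu)$ in the lattice of noncrossing arc diagrams contained in $\mathrm{arcs}(\mathcal X\mathcal Y)$. -/

import Mathlib

universe u v

namespace ArcHopf

open Finset

/-! ### The weak order on the permutations of `Fin n`

A permutation `σ₁ … σₙ` is the word `σ 0, …, σ (n-1)`: arguments are positions, images are values.
All positions and values are indexed from `0` instead of `1`. -/

/-- The inversion set: the pairs `(σ i, σ j)` of values with `i < j` and `σ i > σ j`. -/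
def invSet {n : ℕ} (σ : Equiv.Perm (Fin n)) : Set (Fin n × Fin n) :=
  {p | ∃ i j : Fin n, i < j ∧ σ j < σ i ∧ p = (σ i, σ j)}

theorem mem_invSet {n : ℕ} (σ : Equiv.Perm (Fin n)) (b a : Fin n) :
    (b, a) ∈ invSet σ ↔ a < b ∧ σ.symm b < σ.symm a := by
  constructor
  · rintro ⟨i, j, hij, hσ, h⟩
    obtain ⟨rfl, rfl⟩ := Prod.mk.inj h
    simpa using ⟨hσ, hij⟩
  · rintro ⟨h1, h2⟩
    exact ⟨σ.symm b, σ.symm a, h2, by simpa using h1, by simp⟩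

/-- The weak order: inclusion of inversion sets. -/
instance weakOrder (n : ℕ) : PartialOrder (Equiv.Perm (Fin n)) where
  le σ τ := invSet σ ⊆ invSet τ
  le_refl _ := subset_rfl
  le_trans _ _ _ h₁ h₂ := h₁.trans h₂
  le_antisymm σ τ h₁ h₂ := by
    have key : ∀ a b : Fin n, σ.symm a < σ.symm b → τ.symm a < τ.symm b := by
      intro a b hab
      rcases lt_trichotomy a b with h | h | h
      · by_contra hc
        have hne : τ.symm b ≠ τ.symm a := fun e => h.ne' (τ.symm.injective e)
        have := h₂ ((mem_invSet τ b a).2 ⟨h, lt_of_le_of_ne (not_lt.1 hc) hne⟩)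
        exact absurd ((mem_invSet σ b a).1 this).2 (not_lt.2 hab.le)
      · exact absurd hab (by simp [h])
      · exact ((mem_invSet τ a b).1 (h₁ ((mem_invSet σ a b).2 ⟨h, hab⟩))).2
    have hmono : StrictMono (fun i => τ.symm (σ i)) := by
      intro i j hij
      exact key _ _ (by simpa using hij)
    have hsurj : Function.Surjective (fun i => τ.symm (σ i)) :=
      τ.symm.surjective.comp σ.surjective
    have hid : hmono.orderIsoOfSurjective _ hsurj = OrderIso.refl (Fin n) :=
      Subsingleton.elim _ _
    ext1 i
    have : τ.symm (σ i) = i := by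
      have := congrArg (fun e => e i) hid
      simpa using this
    exact (Equiv.symm_apply_eq τ).1 this

theorem weakOrder_le_iff {n : ℕ} (σ τ : Equiv.Perm (Fin n)) :
    σ ≤ τ ↔ ∀ a b : Fin n, a < b → σ.symm b < σ.symm a → τ.symm b < τ.symm a := by
  constructor
  · intro h a b hab h1
    exact ((mem_invSet τ b a).1 (h ((mem_invSet σ b a).2 ⟨hab, h1⟩))).2
  · rintro h ⟨b, a⟩ hp
    have := (mem_invSet σ b a).1 hp
    exact (mem_invSet τ b a).2 ⟨this.1, h a b this.1 this.2⟩

/-- A transitive and cotransitive set of pairs is an inversion set. -/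
theorem exists_perm_of_biclosed {n : ℕ} (T : Fin n → Fin n → Prop)
    (hgt : ∀ {b a}, T b a → a < b)
    (htrans : ∀ {c b a}, T c b → T b a → T c a)
    (hco : ∀ {c b a}, T c a → a < b → b < c → T c b ∨ T b a) :
    ∃ ρ : Equiv.Perm (Fin n), ∀ a b : Fin n, a < b → (ρ.symm b < ρ.symm a ↔ T b a) := by
  classical
  let r : Fin n → Fin n → Prop := fun u v => T u v ∨ (u < v ∧ ¬ T v u)
  have hirr : ∀ u, ¬ r u u := by
    rintro u (h | h)
    · exact (hgt h).false
    · exact h.1.false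
  have htr : ∀ u v w, r u v → r v w → r u w := by
    rintro u v w (h | ⟨h, h'⟩) (k | ⟨k, k'⟩)
    · exact Or.inl (htrans h k)
    · rcases lt_trichotomy u w with e | e | e
      · exact Or.inr ⟨e, fun q => k' (htrans q h)⟩
      · subst e; exact absurd h k'
      · exact Or.inl ((hco h k e).resolve_right k' |> fun q => q)
    · rcases lt_trichotomy u w with e | e | e
      · exact Or.inr ⟨e, fun q => h' (htrans k q)⟩
      · subst e; exact absurd k h'
      · exact Or.inl ((hco k e h).resolve_left h')
    · exact Or.inr ⟨h.trans k, fun q => (hco q h k).elim k' h'⟩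
  have htri : ∀ u v, r u v ∨ u = v ∨ r v u := by
    intro u v
    rcases lt_trichotomy u v with e | e | e
    · by_cases q : T v u
      · exact Or.inr (Or.inr (Or.inl q))
      · exact Or.inl (Or.inr ⟨e, q⟩)
    · exact Or.inr (Or.inl e)
    · by_cases q : T u v
      · exact Or.inl (Or.inl q)
      · exact Or.inr (Or.inr (Or.inr ⟨e, q⟩))
  have : IsStrictTotalOrder (Fin n) r :=
    { irrefl := hirr
      trans := htr
      trichotomous := fun u v h₁ h₂ => by
        rcases htri u v with h | h | h
        · exact absurd h h₁
        · exact h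
        · exact absurd h h₂ }
  let L : LinearOrder (Fin n) := linearOrderOfSTO r
  let e := @Fintype.orderIsoFinOfCardEq (Fin n) L _ n (Fintype.card_fin n)
  refine ⟨e.toEquiv, fun a b hab => ?_⟩
  have h1 : e.toEquiv.symm b < e.toEquiv.symm a ↔ r b a :=
    @OrderIso.lt_iff_lt (Fin n) (Fin n) L.toPreorder _ (@OrderIso.symm _ _ _ L.toLE e) b a
  rw [h1]
  exact ⟨fun h => h.resolve_right fun q => (hab.trans q.1).false, Or.inl⟩

theorem exists_isLUB_weakOrder {n : ℕ} (σ τ : Equiv.Perm (Fin n)) :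
    ∃ ρ : Equiv.Perm (Fin n), IsLUB {σ, τ} ρ := by
  let R : Fin n → Fin n → Prop := fun b a =>
    a < b ∧ (σ.symm b < σ.symm a ∨ τ.symm b < τ.symm a)
  have hgt : ∀ {b a}, Relation.TransGen R b a → a < b := by
    intro b a h
    induction h with
    | single h => exact h.1
    | tail _ h ih => exact h.1.trans ih
  have hcoR : ∀ {c b a}, R c a → a < b → b < c → R c b ∨ R b a := by
    rintro c b a ⟨_, h⟩ hab hbc
    rcases h with h | h
    · rcases lt_or_ge (σ.symm c) (σ.symm b) with q | q
      · exact Or.inl ⟨hbc, Or.inl q⟩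
      · exact Or.inr ⟨hab, Or.inl (lt_of_le_of_lt q h)⟩
    · rcases lt_or_ge (τ.symm c) (τ.symm b) with q | q
      · exact Or.inl ⟨hbc, Or.inr q⟩
      · exact Or.inr ⟨hab, Or.inr (lt_of_le_of_lt q h)⟩
  have hco : ∀ {c b a}, Relation.TransGen R c a → a < b → b < c →
      Relation.TransGen R c b ∨ Relation.TransGen R b a := by
    intro c b a h
    induction h with
    | single h =>
      intro h1 h2
      exact (hcoR h h1 h2).imp Relation.TransGen.single Relation.TransGen.single
    | @tail x a hx h ih =>
      intro h1 h2
      rcases lt_trichotomy b x with q | q | q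
      · rcases hcoR h h1 q with k | k
        · exact Or.inl (hx.tail k)
        · exact Or.inr (.single k)
      · subst q; exact Or.inl hx
      · exact (ih q h2).imp id fun k => k.tail h
  obtain ⟨ρ, hρ⟩ := exists_perm_of_biclosed (Relation.TransGen R) hgt
    (fun h k => h.trans k) hco
  refine ⟨ρ, ?_, ?_⟩
  · rintro x (rfl | rfl)
    · exact (weakOrder_le_iff _ _).2 fun a b hab h =>
        (hρ a b hab).2 (.single ⟨hab, Or.inl h⟩)
    · exact (weakOrder_le_iff _ _).2 fun a b hab h =>
        (hρ a b hab).2 (.single ⟨hab, Or.inr h⟩)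
  · intro x hx
    have h1 := (weakOrder_le_iff _ _).1 (hx (Or.inl rfl))
    have h2 := (weakOrder_le_iff _ _).1 (hx (Or.inr rfl))
    have key : ∀ b a, Relation.TransGen R b a → x.symm b < x.symm a := by
      intro b a h
      induction h with
      | single h => exact h.2.elim (h1 _ _ h.1) (h2 _ _ h.1)
      | tail _ h ih => exact ih.trans (h.2.elim (h1 _ _ h.1) (h2 _ _ h.1))
    exact (weakOrder_le_iff _ _).2 fun a b hab h => key b a ((hρ a b hab).1 h)

/-- Reversing words is an order-reversing involution of the weak order. -/
theorem weakOrder_rev_le_iff {n : ℕ} (σ τ : Equiv.Perm (Fin n)) :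
    Fin.revPerm.trans σ ≤ Fin.revPerm.trans τ ↔ τ ≤ σ := by
  have hlt : ∀ (ρ : Equiv.Perm (Fin n)) (a b : Fin n),
      (Fin.revPerm.trans ρ).symm b < (Fin.revPerm.trans ρ).symm a ↔ ρ.symm a < ρ.symm b := by
    intro ρ a b
    simp
  simp only [weakOrder_le_iff, hlt]
  constructor
  · intro h a b hab h1
    by_contra hc
    have hne : σ.symm a ≠ σ.symm b := fun e => hab.ne (σ.symm.injective e)
    exact absurd (h a b hab (lt_of_le_of_ne (not_lt.1 hc) hne)) (not_lt.2 h1.le)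
  · intro h a b hab h1
    by_contra hc
    have hne : τ.symm b ≠ τ.symm a := fun e => hab.ne' (τ.symm.injective e)
    exact absurd (h a b hab (lt_of_le_of_ne (not_lt.1 hc) hne)) (not_lt.2 h1.le)

theorem exists_isGLB_weakOrder {n : ℕ} (σ τ : Equiv.Perm (Fin n)) :
    ∃ ρ : Equiv.Perm (Fin n), IsGLB {σ, τ} ρ := by
  have hinv : ∀ x : Equiv.Perm (Fin n), Fin.revPerm.trans (Fin.revPerm.trans x) = x := by
    intro x
    ext i
    simp
  obtain ⟨ρ, h1, h2⟩ := exists_isLUB_weakOrder (Fin.revPerm.trans σ) (Fin.revPerm.trans τ)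
  refine ⟨Fin.revPerm.trans ρ, ?_, ?_⟩
  · rintro x (rfl | rfl)
    · rw [← weakOrder_rev_le_iff, hinv]; exact h1 (Or.inl rfl)
    · rw [← weakOrder_rev_le_iff, hinv]; exact h1 (Or.inr rfl)
  · intro x hx
    rw [← weakOrder_rev_le_iff, hinv]
    apply h2
    rintro y (rfl | rfl)
    · rw [weakOrder_rev_le_iff]; exact hx (Or.inl rfl)
    · rw [weakOrder_rev_le_iff]; exact hx (Or.inr rfl)

/-- The weak order is a lattice. -/
noncomputable instance weakLattice (n : ℕ) : Lattice (Equiv.Perm (Fin n)) where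
  __ := weakOrder n
  sup σ τ := (exists_isLUB_weakOrder σ τ).choose
  le_sup_left σ τ := (exists_isLUB_weakOrder σ τ).choose_spec.1 (Or.inl rfl)
  le_sup_right σ τ := (exists_isLUB_weakOrder σ τ).choose_spec.1 (Or.inr rfl)
  sup_le σ τ ρ h₁ h₂ := (exists_isLUB_weakOrder σ τ).choose_spec.2 (by
    rintro x (rfl | rfl)
    exacts [h₁, h₂])
  inf σ τ := (exists_isGLB_weakOrder σ τ).choose
  inf_le_left σ τ := (exists_isGLB_weakOrder σ τ).choose_spec.1 (Or.inl rfl)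
  inf_le_right σ τ := (exists_isGLB_weakOrder σ τ).choose_spec.1 (Or.inr rfl)
  le_inf σ τ ρ h₁ h₂ := (exists_isGLB_weakOrder τ ρ).choose_spec.2 (by
    rintro x (rfl | rfl)
    exacts [h₁, h₂])

/-! ### Arcs and noncrossing arc diagrams -/

/-- An arc `(a, b, n, S)` with `a < b` in `[n]` and `S ⊆ ]a,b[`. -/
structure Arc (n : ℕ) where
  left : Fin n
  right : Fin n
  above : Finset (Fin n)
  lt : left < right
  subset : above ⊆ Ioo left right

theorem Arc.ext_fields {n : ℕ} {α β : Arc n} (h₁ : α.left = β.left) (h₂ : α.right = β.right)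
    (h₃ : α.above = β.above) : α = β := by
  cases α; cases β; simp_all

noncomputable instance Arc.instDecidableEq (n : ℕ) : DecidableEq (Arc n) := Classical.decEq _

noncomputable instance Arc.instFintype (n : ℕ) : Fintype (Arc n) :=
  Fintype.ofInjective (fun α : Arc n => (α.left, α.right, α.above)) (fun α β h => by
    simp only [Prod.mk.injEq] at h
    exact Arc.ext_fields h.1 h.2.1 h.2.2)

/-- The arc `(σ_j, σ_i, n, {σ_k | k < i, σ_k ∈ ]σ_j, σ_i[})` of a pair `(i, j)` of positions with
`σ_j < σ_i`. -/
def arcOf {n : ℕ} (σ : Equiv.Perm (Fin n)) (i j : Fin n) (h : σ j < σ i) : Arc n where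
  left := σ j
  right := σ i
  above := (Ioo (σ j) (σ i)).filter fun v => σ.symm v < i
  lt := h
  subset := filter_subset _ _

open Classical in
/-- `δ(σ)`: the set of arcs of all descents `σ_i > σ_{i+1}` of `σ`. -/
noncomputable def descentDiagram {n : ℕ} (σ : Equiv.Perm (Fin n)) : Finset (Arc n) :=
  univ.filter fun α => ∃ (i j : Fin n) (h : σ j < σ i), (j : ℕ) = i + 1 ∧ α = arcOf σ i j h

/-- Two arcs `(a, b, n, R)` and `(c, d, n, S)` cross if each of them is, at some point of
`([a,b] ∩ [c,d]) \ ({a,b} ∩ {c,d})`, above the other one. -/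
def Arc.Cross {n : ℕ} (α β : Arc n) : Prop :=
  ∃ r ∈ (Icc α.left α.right ∩ Icc β.left β.right) \
      (({α.left, α.right} : Finset (Fin n)) ∩ {β.left, β.right}),
  ∃ s ∈ (Icc α.left α.right ∩ Icc β.left β.right) \
      (({α.left, α.right} : Finset (Fin n)) ∩ {β.left, β.right}),
    r ∈ (α.above ∪ {α.left, α.right}) \ β.above ∧
    s ∈ (β.above ∪ {β.left, β.right}) \ α.above

/-- Noncrossing arc diagrams: any two distinct arcs do not cross, and have distinct left endpoints
and distinct right endpoints. -/
def IsNoncrossing {n : ℕ} (D : Finset (Arc n)) : Prop :=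
  ∀ α ∈ D, ∀ β ∈ D, α ≠ β → ¬ α.Cross β ∧ α.left ≠ β.left ∧ α.right ≠ β.right

/-! ### Arc ideals and lattice congruences of the weak order -/

/-- The restriction `(b, c, n, S ∩ ]b,c[)` of an arc `(a, d, n, S)`. -/
def Arc.restrict {n : ℕ} (α : Arc n) (b c : Fin n) (h : b < c) : Arc n where
  left := b
  right := c
  above := α.above ∩ Ioo b c
  lt := h
  subset := inter_subset_right

/-- Arc ideals: sets of arcs containing, with an arc `(a, d, n, S)`, all its restrictions
to `[b, c]` for `a ≤ b < c ≤ d`. -/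
structure ArcIdeal (n : ℕ) where
  carrier : Set (Arc n)
  restrict_mem : ∀ α ∈ carrier, ∀ (b c : Fin n) (h : b < c), α.left ≤ b → c ≤ α.right →
    α.restrict b c h ∈ carrier

open Classical in
/-- The bottom element of the class of `σ` for a lattice congruence of the weak order, as the meet
of that (finite) class. -/
noncomputable def projDown {n : ℕ} (r : LatticeCon (Equiv.Perm (Fin n)))
    (σ : Equiv.Perm (Fin n)) : Equiv.Perm (Fin n) :=
  (univ.filter fun τ => r.r σ τ).inf' ⟨σ, by simp⟩ id

/-- The arcs `δ(σ) = {α}` of the join-irreducible permutations `σ` (those covering exactly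
one element) that are not contracted by `r`. -/
def uncontractedArcs {n : ℕ} (r : LatticeCon (Equiv.Perm (Fin n))) : Set (Arc n) :=
  {α | ∃ σ : Equiv.Perm (Fin n), (∃! τ, τ ⋖ σ) ∧ projDown r σ = σ ∧ descentDiagram σ = {α}}

/-- The lattice congruence of the weak order whose set of uncontracted arcs is the arc ideal `I`
(there is exactly one; it is written as the intersection of all of them). -/
def arcCongruence {n : ℕ} (I : ArcIdeal n) : LatticeCon (Equiv.Perm (Fin n)) where
  r σ τ := ∀ r : LatticeCon (Equiv.Perm (Fin n)), uncontractedArcs r = I.carrier → r.r σ τ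
  iseqv :=
    { refl := fun σ r _ => r.iseqv.refl σ
      symm := fun h r hr => r.iseqv.symm (h r hr)
      trans := fun h h' r hr => r.iseqv.trans (h r hr) (h' r hr) }
  inf h h' r hr := r.inf (h r hr) (h' r hr)
  sup h h' r hr := r.sup (h r hr) (h' r hr)

/-- The surjection `η_I(σ) = δ(π_↓(σ))` onto the noncrossing arc diagrams in `I`. -/
noncomputable def eta {n : ℕ} (I : ArcIdeal n) (σ : Equiv.Perm (Fin n)) : Finset (Arc n) :=
  descentDiagram (projDown (arcCongruence I) σ)

/-- The order of the lattice of noncrossing arc diagrams in `I`, i.e. of the lattice quotient of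
the weak order: two classes are comparable if some of their representatives are. -/
def DiagramLE {n : ℕ} (I : ArcIdeal n) (D E : Finset (Arc n)) : Prop :=
  ∃ σ τ : Equiv.Perm (Fin n), eta I σ = D ∧ eta I τ = E ∧ σ ≤ τ

open Classical in
/-- The interval between `L` and `U` in the lattice of noncrossing arc diagrams in `I`. -/
noncomputable def diagramInterval {n : ℕ} (I : ArcIdeal n) (L U : Finset (Arc n)) :
    Finset (Finset (Arc n)) :=
  univ.filter fun F => IsNoncrossing F ∧ (F : Set (Arc n)) ⊆ I.carrier ∧
    DiagramLE I L F ∧ DiagramLE I F U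

/-! ### Decoration sets and conservative functions -/

theorem card_union_shift {m n k l : ℕ} {R : Finset (Fin m)} (hR : R.card = k)
    {S : Finset (Fin n)} (hS : S.card = l) :
    (R.map (Fin.castAddEmb n) ∪ S.map (Fin.natAddEmb m)).card = k + l := by
  rw [card_union_of_disjoint, card_map, card_map, hR, hS]
  rw [disjoint_left]
  intro x hx hy
  obtain ⟨a, _, rfl⟩ := mem_map.1 hx
  obtain ⟨b, _, h⟩ := mem_map.1 hy
  have := congrArg Fin.val h
  simp at this
  omega

/-- A decoration set: a graded set with an associative concatenation and a compatible selection.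
For `R = {r_1 < ⋯ < r_q}`, the element `r_s` is `R.orderEmbOfFin hR s`. -/
structure DecorationSet where
  carrier : ℕ → Type u
  concat : ∀ {m n : ℕ}, carrier m → carrier n → carrier (m + n)
  select : ∀ {m k : ℕ}, carrier m → ∀ R : Finset (Fin m), R.card = k → carrier k
  concat_assoc : ∀ {m n p : ℕ} (X : carrier m) (Y : carrier n) (Z : carrier p),
    HEq (concat X (concat Y Z)) (concat (concat X Y) Z)
  select_select : ∀ {p q k : ℕ} (X : carrier p) (R : Finset (Fin p)) (hR : R.card = q)
    (S : Finset (Fin q)) (hS : S.card = k),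
    select (select X R hR) S hS =
      select X (S.map (R.orderEmbOfFin hR).toEmbedding) ((card_map _).trans hS)
  concat_select : ∀ {m n k l : ℕ} (X : carrier m) (Y : carrier n)
    (R : Finset (Fin m)) (hR : R.card = k) (S : Finset (Fin n)) (hS : S.card = l),
    concat (select X R hR) (select Y S hS) =
      select (concat X Y) (R.map (Fin.castAddEmb n) ∪ S.map (Fin.natAddEmb m))
        (card_union_shift hR hS)

/-- The augmented arc `(a, b, m + n, S)`. -/
def Arc.augment {m : ℕ} (α : Arc m) (n : ℕ) : Arc (m + n) where
  left := Fin.castAdd n α.left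
  right := Fin.castAdd n α.right
  above := α.above.map (Fin.castAddEmb n)
  lt := α.lt
  subset := by
    intro x hx
    obtain ⟨y, hy, rfl⟩ := mem_map.1 hx
    have h := mem_Ioo.1 (α.subset hy)
    exact mem_Ioo.2 ⟨h.1, h.2⟩

/-- The shifted arc `(a + m, b + m, m + n, {s + m | s ∈ S})`. -/
def Arc.shift {n : ℕ} (α : Arc n) (m : ℕ) : Arc (m + n) where
  left := Fin.natAdd m α.left
  right := Fin.natAdd m α.right
  above := α.above.map (Fin.natAddEmb m)
  lt := by simpa using α.lt
  subset := by
    intro x hx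
    obtain ⟨y, hy, rfl⟩ := mem_map.1 hx
    simpa using α.subset hy

/-- The arc `(a, b, q, {c ∈ [q] | r_c ∈ S})` obtained from `(r_a, r_b, p, S)`. -/
def selectArc {p q : ℕ} (r : Fin q ↪o Fin p) (a b : Fin q) (hab : a < b)
    (S : Finset (Fin p)) (hS : S ⊆ Ioo (r a) (r b)) : Arc q where
  left := a
  right := b
  above := univ.filter fun c => r c ∈ S
  lt := hab
  subset := by
    intro c hc
    simpa using hS (mem_filter.1 hc).2

/-- A conservative function from a decoration set to arc ideals. -/
structure ConservativeFunction (𝔛 : DecorationSet.{u}) where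
  arcs : ∀ {n : ℕ}, 𝔛.carrier n → ArcIdeal n
  augment_mem : ∀ {m n : ℕ} (X : 𝔛.carrier m) (Y : 𝔛.carrier n),
    ∀ α ∈ (arcs X).carrier, α.augment n ∈ (arcs (𝔛.concat X Y)).carrier
  shift_mem : ∀ {m n : ℕ} (X : 𝔛.carrier m) (Y : 𝔛.carrier n),
    ∀ α ∈ (arcs Y).carrier, α.shift m ∈ (arcs (𝔛.concat X Y)).carrier
  select_mem : ∀ {p q : ℕ} (Z : 𝔛.carrier p) (R : Finset (Fin p)) (hR : R.card = q)
    (a b : Fin q) (hab : a < b) (S : Finset (Fin p))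
    (hS : S ⊆ Ioo (R.orderEmbOfFin hR a) (R.orderEmbOfFin hR b)),
    (⟨R.orderEmbOfFin hR a, R.orderEmbOfFin hR b, S,
        (R.orderEmbOfFin hR).lt_iff_lt.2 hab, hS⟩ : Arc p) ∈ (arcs Z).carrier →
      selectArc (R.orderEmbOfFin hR) a b hab S hS ∈ (arcs (𝔛.select Z R hR)).carrier

/-! ### The algebra of decorated permutations -/

/-- The standardization of the word obtained from `ρ` by deleting the entries whose values are not
in `R`: the `i`-th remaining position is sent to the rank in `R` of the entry there. -/
def stdVal {p q : ℕ} (ρ : Equiv.Perm (Fin p)) (R : Finset (Fin p)) (hR : R.card = q) :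
    Equiv.Perm (Fin q) :=
  (((R.map ρ.symm.toEmbedding).orderIsoOfFin ((card_map _).trans hR)).toEquiv.trans
    (ρ.subtypeEquiv fun a => by simp)).trans
      (R.orderIsoOfFin hR).toEquiv.symm

/-- The shifted shuffle of `σ` and `τ`: the permutations of `[m+n]` whose standardization
on the values `[m]` is `σ` and whose standardization on the values `[m+n] \ [m]` is `τ`. -/
def shiftedShuffle {m n : ℕ} (σ : Equiv.Perm (Fin m)) (τ : Equiv.Perm (Fin n)) :
    Finset (Equiv.Perm (Fin (m + n))) :=
  univ.filter fun ρ =>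
    stdVal ρ (univ.map (Fin.castAddEmb n)) (by simp) = σ ∧
    stdVal ρ (univ.map (Fin.natAddEmb m)) (by simp) = τ

/-- `σ \ τ`, the word `σ_1 … σ_m (m + τ_1) … (m + τ_n)`. -/
def backslash {m n : ℕ} (σ : Equiv.Perm (Fin m)) (τ : Equiv.Perm (Fin n)) :
    Equiv.Perm (Fin (m + n)) :=
  (finSumFinEquiv.symm.trans (Equiv.sumCongr σ τ)).trans finSumFinEquiv

/-- `τ / σ`, the word `(m + τ_1) … (m + τ_n) σ_1 … σ_m`. -/
def slash {m n : ℕ} (τ : Equiv.Perm (Fin n)) (σ : Equiv.Perm (Fin m)) :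
    Equiv.Perm (Fin (m + n)) :=
  ((((finCongr (Nat.add_comm m n)).trans finSumFinEquiv.symm).trans
    (Equiv.sumComm (Fin n) (Fin m))).trans (Equiv.sumCongr σ τ)).trans finSumFinEquiv

/-- Decorated permutations of arbitrary size. -/
abbrev DecPerm (𝔛 : DecorationSet.{u}) : Type u :=
  Σ n : ℕ, Equiv.Perm (Fin n) × 𝔛.carrier n

/-- The vector space with basis the decorated permutations. -/
abbrev DecPermSpace (k : Type v) [Field k] (𝔛 : DecorationSet.{u}) : Type (max u v) :=
  DecPerm 𝔛 →₀ k

/-- The basis vector `F_(σ, X)`. -/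
noncomputable def basisF (k : Type v) [Field k] (𝔛 : DecorationSet.{u}) {n : ℕ}
    (σ : Equiv.Perm (Fin n)) (X : 𝔛.carrier n) : DecPermSpace k 𝔛 :=
  Finsupp.single ⟨n, σ, X⟩ 1

/-- The product: the bilinear extension of
`F_(σ,X) · F_(τ,Y) = ∑ F_(ρ, X·Y)` over the shifted shuffle of `σ` and `τ`. -/
noncomputable def product (k : Type v) [Field k] (𝔛 : DecorationSet.{u}) :
    DecPermSpace k 𝔛 →ₗ[k] DecPermSpace k 𝔛 →ₗ[k] DecPermSpace k 𝔛 :=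
  Finsupp.linearCombination k fun p : DecPerm 𝔛 =>
    Finsupp.linearCombination k fun q : DecPerm 𝔛 =>
      ∑ ρ ∈ shiftedShuffle p.2.1 q.2.1, basisF k 𝔛 ρ (𝔛.concat p.2.2 q.2.2)

open Classical in
/-- `P_(D, X)`: the sum of `F_(σ, X)` over the permutations `σ` with `η_{arcs(X)}(σ) = D`. -/
noncomputable def basisP (k : Type v) [Field k] {𝔛 : DecorationSet.{u}}
    (A : ConservativeFunction 𝔛) {n : ℕ} (D : Finset (Arc n)) (X : 𝔛.carrier n) :
    DecPermSpace k 𝔛 :=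
  ∑ σ ∈ univ.filter (fun σ : Equiv.Perm (Fin n) => eta (A.arcs X) σ = D), basisF k 𝔛 σ X

end ArcHopf

/-!
For an arc ideal `I`, let `σ ≲ τ` mean that `τ` lies above every join-irreducible permutation with
arc in `I` that `σ` lies above; this preorder is compatible with meets. A permutation fails to be
below the meet-irreducible of an arc exactly if it is above the join-irreducible of some restriction
of that arc, and dually, so `≲` can also be read off from meet-irreducibles and is compatible with
joins. Its symmetrization is therefore a lattice congruence, and it is the one with uncontracted
arcs `I`. Every permutation is the join of the join-irreducibles of the arcs in its descent diagram,
and the noncrossing diagrams are exactly those that occur, which identifies the classes.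

The join-irreducible of an augmented (shifted) arc lies below `ρ` iff that of the original arc lies
below the subword of `ρ` on the low (standardized high) values. Hence taking these subwords is
monotone for the preorders of `arcs (XY)`, `arcs X` and `arcs Y`, so the class of `ρ` lies between
those of `μ \ λ` and `ω / ν` iff its two subwords lie in the classes of `D` and `E`, and these `ρ`
are the terms of the product.
-/

namespace ArcHopf

open Finset

section WeakOrder

variable {n : ℕ}

instance weakOrderBot (n : ℕ) : OrderBot (Equiv.Perm (Fin n)) where
  bot := 1
  bot_le σ := (weakOrder_le_iff 1 σ).2 fun _ _ hab h => absurd h hab.asymm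

theorem symm_lt_symm_of_not_lt {σ : Equiv.Perm (Fin n)} {a b : Fin n} (hab : a ≠ b)
    (h : ¬ σ.symm b < σ.symm a) : σ.symm a < σ.symm b :=
  (not_lt.1 h).lt_of_ne (σ.symm.injective.ne hab)

theorem symm_lt_symm_of_le {ρ σ : Equiv.Perm (Fin n)} (h : ρ ≤ σ) {a b : Fin n} (hab : a < b)
    (hσ : σ.symm a < σ.symm b) : ρ.symm a < ρ.symm b :=
  symm_lt_symm_of_not_lt hab.ne fun hρ => ((weakOrder_le_iff ρ σ).1 h a b hab hρ).asymm hσ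

theorem mem_descentDiagram {σ : Equiv.Perm (Fin n)} {α : Arc n} :
    α ∈ descentDiagram σ ↔ σ.symm α.right ⋖ σ.symm α.left ∧
      ∀ v ∈ Ioo α.left α.right, (v ∈ α.above ↔ σ.symm v < σ.symm α.right) := by
  simp only [descentDiagram, mem_filter_univ, Fin.covBy_iff, Nat.covBy_iff_add_one_eq]
  constructor
  · rintro ⟨i, j, hji, hj, rfl⟩
    simp only [arcOf, Equiv.symm_apply_apply, mem_filter]
    exact ⟨hj.symm, fun v hv => and_iff_right hv⟩
  · rintro ⟨hcov, habove⟩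
    refine ⟨σ.symm α.right, σ.symm α.left, by simpa using α.lt, hcov.symm,
      Arc.ext_fields (by simp [arcOf]) (by simp [arcOf]) ?_⟩
    ext v
    simp only [arcOf, Equiv.apply_symm_apply, mem_filter]
    exact ⟨fun hv => ⟨α.subset hv, (habove v (α.subset hv)).1 hv⟩,
      fun hv => (habove v hv.1).2 hv.2⟩

theorem exists_mem_descentDiagram {σ : Equiv.Perm (Fin n)} {x y : Fin n} (hxy : x < y)
    (h : σ.symm y ⋖ σ.symm x) : ∃ α ∈ descentDiagram σ, α.left = x ∧ α.right = y :=
  ⟨⟨x, y, {v ∈ Ioo x y | σ.symm v < σ.symm y}, hxy, filter_subset _ _⟩,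
    mem_descentDiagram.2 ⟨h, fun v hv => by simp [mem_filter, mem_Ioo.1 hv]⟩, rfl, rfl⟩

theorem le_of_inverts_descents {ρ σ : Equiv.Perm (Fin n)} (hρσ : ρ ≤ σ)
    (h : ∀ α ∈ descentDiagram σ, ρ.symm α.right < ρ.symm α.left) : σ ≤ ρ := by
  have hmono : StrictMono fun i => ρ.symm (σ i) := by
    refine strictMono_of_lt_succ fun i hi => ?_
    have hcov : i ⋖ Order.succ i := Order.covBy_succ_of_not_isMax hi
    rcases lt_or_gt_of_ne (σ.injective.ne hcov.lt.ne) with hasc | hdesc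
    · exact symm_lt_symm_of_le hρσ hasc (by simpa using hcov.lt)
    · obtain ⟨α, hα, hleft, hright⟩ :=
        exists_mem_descentDiagram (σ := σ) hdesc (by simpa using hcov)
      simpa [hleft, hright] using h α hα
  refine (weakOrder_le_iff σ ρ).2 fun a b _ hσ => ?_
  simpa using hmono hσ

end WeakOrder

section ArcInversions

variable {n : ℕ}

namespace Arc

variable (α β : Arc n)

/-- `(y, x)` is an inversion of the smallest permutation whose word has the descent
`α.right, α.left` with the values of `α.above` in front of it: `x` occurs weakly after that descent
and `y` weakly before it. -/
def Inv (y x : Fin n) : Prop :=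
  α.left ≤ x ∧ x < y ∧ y ≤ α.right ∧ x ∉ α.above ∧ (y ∈ α.above ∨ y = α.right)

/-- Dually to `Arc.Inv`, the pair `x < y` is a noninversion of the largest permutation whose word
has the ascent `α.left, α.right` with exactly the values of `α.above` among `]α.left, α.right[` in
front of it. -/
def Noninv (y x : Fin n) : Prop :=
  α.left ≤ x ∧ x < y ∧ y ≤ α.right ∧ (x ∈ α.above ∨ x = α.left) ∧ y ∉ α.above

theorem left_notMem_above : α.left ∉ α.above := fun h => (mem_Ioo.1 (α.subset h)).1.false

theorem right_notMem_above : α.right ∉ α.above := fun h => (mem_Ioo.1 (α.subset h)).2.false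

theorem inv_right_left : α.Inv α.right α.left :=
  ⟨le_rfl, α.lt, le_rfl, α.left_notMem_above, Or.inr rfl⟩

theorem noninv_right_left : α.Noninv α.right α.left :=
  ⟨le_rfl, α.lt, le_rfl, Or.inr rfl, α.right_notMem_above⟩

variable {α β}

theorem Inv.lt {x y : Fin n} (h : α.Inv y x) : x < y := h.2.1

theorem Noninv.lt {x y : Fin n} (h : α.Noninv y x) : x < y := h.2.1

theorem restrict_self (α : Arc n) : α.restrict α.left α.right α.lt = α :=
  Arc.ext_fields rfl rfl (inter_eq_left.2 α.subset)

variable (α)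

theorem exists_joinIrr :
    ∃ σ : Equiv.Perm (Fin n), ∀ x y, x < y → (σ.symm y < σ.symm x ↔ α.Inv y x) := by
  refine exists_perm_of_biclosed α.Inv Inv.lt ?_ ?_
  · rintro c b a ⟨_, hbc, hright, hb, _⟩ ⟨_, _, _, _, hb'⟩
    obtain rfl := hb'.resolve_left hb
    exact absurd hright (not_le.2 hbc)
  · rintro c b a ⟨hleft, _, hright, ha, hc⟩ hab hbc
    by_cases hb : b ∈ α.above
    · exact Or.inr ⟨hleft, hab, hbc.le.trans hright, ha, Or.inl hb⟩
    · exact Or.inl ⟨hleft.trans hab.le, hbc, hright, hb, hc⟩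

/-- The join-irreducible permutation with descent diagram `{α}`. -/
noncomputable def joinIrr : Equiv.Perm (Fin n) := α.exists_joinIrr.choose

variable {α} in
theorem joinIrr_symm_lt_iff {x y : Fin n} (hxy : x < y) :
    α.joinIrr.symm y < α.joinIrr.symm x ↔ α.Inv y x :=
  α.exists_joinIrr.choose_spec x y hxy

theorem exists_meetIrr :
    ∃ σ : Equiv.Perm (Fin n), ∀ x y, x < y → (σ.symm y < σ.symm x ↔ x < y ∧ ¬ α.Noninv y x) := by
  refine exists_perm_of_biclosed (fun y x => x < y ∧ ¬ α.Noninv y x) And.left ?_ ?_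
  · rintro c b a ⟨hbc, hcb⟩ ⟨hab, hba⟩
    refine ⟨hab.trans hbc, fun ⟨hleft, _, hright, ha, hc⟩ => ?_⟩
    by_cases hb : b ∈ α.above
    · exact hcb ⟨hleft.trans hab.le, hbc, hright, Or.inl hb, hc⟩
    · exact hba ⟨hleft, hab, hbc.le.trans hright, ha, hb⟩
  · rintro c b a ⟨_, hca⟩ hab hbc
    by_contra! h
    obtain ⟨_, _, hright, _, hc⟩ := h.1 hbc
    obtain ⟨hleft, _, _, ha, _⟩ := h.2 hab
    exact hca ⟨hleft, hab.trans hbc, hright, ha, hc⟩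

/-- The meet-irreducible permutation whose only ascent is `α.left, α.right`, with exactly the values
of `α.above` among `]α.left, α.right[` in front of it. -/
noncomputable def meetIrr : Equiv.Perm (Fin n) := α.exists_meetIrr.choose

variable {α}

theorem meetIrr_symm_lt_iff {x y : Fin n} (hxy : x < y) :
    α.meetIrr.symm y < α.meetIrr.symm x ↔ ¬ α.Noninv y x :=
  (α.exists_meetIrr.choose_spec x y hxy).trans (and_iff_right hxy)

theorem joinIrr_le_iff {σ : Equiv.Perm (Fin n)} :
    α.joinIrr ≤ σ ↔ ∀ y x, α.Inv y x → σ.symm y < σ.symm x := by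
  rw [weakOrder_le_iff]
  exact ⟨fun h y x hα => h x y hα.lt ((joinIrr_symm_lt_iff hα.lt).2 hα),
    fun h x y hxy hα => h y x ((joinIrr_symm_lt_iff hxy).1 hα)⟩

theorem le_meetIrr_iff {σ : Equiv.Perm (Fin n)} :
    σ ≤ α.meetIrr ↔ ∀ y x, α.Noninv y x → σ.symm x < σ.symm y := by
  rw [weakOrder_le_iff]
  refine ⟨fun h y x hα => symm_lt_symm_of_not_lt hα.lt.ne fun hσ => ?_,
    fun h x y hxy hσ => (meetIrr_symm_lt_iff hxy).2 fun hα => (h y x hα).asymm hσ⟩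
  exact (meetIrr_symm_lt_iff hα.lt).1 (h x y hα.lt hσ) hα

theorem joinIrr_le_meetIrr_iff :
    α.joinIrr ≤ β.meetIrr ↔ ∀ y x, α.Inv y x → ¬ β.Noninv y x := by
  rw [joinIrr_le_iff]
  exact forall₂_congr fun y x => forall_congr' fun h => meetIrr_symm_lt_iff h.lt

theorem joinIrr_not_le_meetIrr (α : Arc n) : ¬ α.joinIrr ≤ α.meetIrr := fun h =>
  joinIrr_le_meetIrr_iff.1 h _ _ α.inv_right_left α.noninv_right_left

theorem Cross.symm (h : α.Cross β) : β.Cross α := by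
  obtain ⟨r, hr, s, hs, hrα, hsβ⟩ := h
  rw [inter_comm (Icc _ _), inter_comm {_, _}] at hr hs
  exact ⟨s, hs, r, hr, hsβ, hrα⟩

theorem Cross.exists_inv_noninv (h : α.Cross β) :
    (∃ y x, α.Inv y x ∧ β.Noninv y x) ∨ ∃ y x, β.Inv y x ∧ α.Noninv y x := by
  obtain ⟨r, hr, s, hs, hrα, hsβ⟩ := h
  simp only [mem_sdiff, mem_inter, mem_Icc, mem_union, mem_insert, mem_singleton] at hr hs hrα hsβ
  rcases lt_trichotomy s r with hsr | rfl | hrs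
  · refine Or.inl ⟨r, s, ?_, ?_⟩ <;> simp only [Inv, Noninv] <;> grind
  · tauto
  · refine Or.inr ⟨s, r, ?_, ?_⟩ <;> simp only [Inv, Noninv] <;> grind

theorem cross_of_inv_noninv (hleft : α.left ≠ β.left) (hright : α.right ≠ β.right) {x y : Fin n}
    (hα : α.Inv y x) (hβ : β.Noninv y x) : α.Cross β := by
  obtain ⟨hαx, hxy, hyα, hx, hy⟩ := hα
  obtain ⟨hβx, -, hyβ, hx', hy'⟩ := hβ
  refine ⟨y, ?_, x, ?_, ?_, ?_⟩ <;>
    simp only [mem_sdiff, mem_inter, mem_Icc, mem_union, mem_insert, mem_singleton] <;> grind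

theorem cross_iff (hleft : α.left ≠ β.left) (hright : α.right ≠ β.right) :
    α.Cross β ↔ ¬ (α.joinIrr ≤ β.meetIrr ∧ β.joinIrr ≤ α.meetIrr) := by
  simp only [joinIrr_le_meetIrr_iff, not_and_or, not_forall, not_not, exists_prop]
  constructor
  · exact Cross.exists_inv_noninv
  · rintro (⟨y, x, hα, hβ⟩ | ⟨y, x, hβ, hα⟩)
    · exact cross_of_inv_noninv hleft hright hα hβ
    · exact (cross_of_inv_noninv hleft.symm hright.symm hβ hα).symm

end Arc

end ArcInversions

section Descents

variable {n : ℕ} {σ τ : Equiv.Perm (Fin n)} {α β : Arc n} {x y : Fin n}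

theorem covBy_of_mem_descentDiagram (hα : α ∈ descentDiagram σ) :
    σ.symm α.right ⋖ σ.symm α.left :=
  (mem_descentDiagram.1 hα).1

theorem symm_lt_symm_right (hα : α ∈ descentDiagram σ) (hx : x ∈ α.above) :
    σ.symm x < σ.symm α.right :=
  ((mem_descentDiagram.1 hα).2 x (α.subset hx)).1 hx

theorem symm_left_lt_symm (hα : α ∈ descentDiagram σ) (hx : x ∈ Ioo α.left α.right)
    (hx' : x ∉ α.above) : σ.symm α.left < σ.symm x := by
  have hright : σ.symm α.right < σ.symm x := symm_lt_symm_of_not_lt (mem_Ioo.1 hx).2.ne'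
    (mt ((mem_descentDiagram.1 hα).2 x hx).2 hx')
  exact ((covBy_of_mem_descentDiagram hα).ge_of_gt hright).lt_of_ne
    (σ.symm.injective.ne (mem_Ioo.1 hx).1.ne)

theorem Arc.Inv.symm_le (h : α.Inv y x) (hα : α ∈ descentDiagram σ) :
    σ.symm y ≤ σ.symm α.right ∧ σ.symm α.left ≤ σ.symm x := by
  obtain ⟨hleft, hxy, hright, hx, hy⟩ := h
  constructor
  · rcases hy with hy | rfl
    exacts [(symm_lt_symm_right hα hy).le, le_rfl]
  · rcases hleft.eq_or_lt with rfl | hleft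
    exacts [le_rfl, (symm_left_lt_symm hα (mem_Ioo.2 ⟨hleft, hxy.trans_le hright⟩) hx).le]

theorem Arc.Noninv.symm_le (h : α.Noninv y x) (hα : α ∈ descentDiagram σ) :
    σ.symm x ≤ σ.symm α.left ∧ σ.symm α.right ≤ σ.symm y := by
  have hcov := (covBy_of_mem_descentDiagram hα).lt
  obtain ⟨hleft, hxy, hright, hx, hy⟩ := h
  constructor
  · rcases hx with hx | rfl
    exacts [((symm_lt_symm_right hα hx).trans hcov).le, le_rfl]
  · rcases hright.eq_or_lt with rfl | hright
    exacts [le_rfl,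
      (hcov.trans (symm_left_lt_symm hα (mem_Ioo.2 ⟨hleft.trans_lt hxy, hright⟩) hy)).le]

theorem joinIrr_le_of_mem_descentDiagram (hα : α ∈ descentDiagram σ) : α.joinIrr ≤ σ :=
  Arc.joinIrr_le_iff.2 fun _ _ h =>
    (h.symm_le hα).1.trans_lt ((covBy_of_mem_descentDiagram hα).lt.trans_le (h.symm_le hα).2)

theorem eq_restrict_of_inv (hα : α ∈ descentDiagram σ) (hβ : β.joinIrr ≤ σ)
    (h : β.Inv α.right α.left) : α = β.restrict α.left α.right α.lt := by
  rw [Arc.joinIrr_le_iff] at hβ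
  obtain ⟨hleft, -, hright, hnotMem, hmem⟩ := h
  refine Arc.ext_fields rfl rfl (Finset.ext fun v => ?_)
  rw [Arc.restrict, mem_inter]
  refine ⟨fun hv => ⟨?_, α.subset hv⟩, fun ⟨hv, hvα⟩ => ?_⟩
  · by_contra hv'
    have hvα := mem_Ioo.1 (α.subset hv)
    exact (hβ α.right v ⟨hleft.trans hvα.1.le, hvα.2, hright, hv', hmem⟩).asymm
      (symm_lt_symm_right hα hv)
  · by_contra hv'
    have hvα' := mem_Ioo.1 hvα
    exact (hβ v α.left ⟨hleft, hvα'.1, hvα'.2.le.trans hright, hnotMem, Or.inl hv⟩).asymm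
      (symm_left_lt_symm hα hvα hv')

theorem eq_of_inv (hα : α ∈ descentDiagram σ) (hβ : β ∈ descentDiagram σ)
    (h : β.Inv α.right α.left) : α = β := by
  have hcov := covBy_of_mem_descentDiagram hα
  have hcov' := covBy_of_mem_descentDiagram hβ
  obtain ⟨hright, hleft⟩ := h.symm_le hβ
  have hleft' : α.left = β.left := σ.symm.injective <| hleft.antisymm' <|
    hcov.ge_of_gt (hright.trans_lt hcov'.lt)
  have hright' : α.right = β.right := σ.symm.injective <| hright.antisymm <|
    hcov.le_of_lt (hcov'.lt.trans_le hleft)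
  rw [eq_restrict_of_inv hα (joinIrr_le_of_mem_descentDiagram hβ) h]
  simp only [hleft', hright', Arc.restrict_self]

theorem mem_descentDiagram_joinIrr (α : Arc n) : α ∈ descentDiagram α.joinIrr := by
  refine mem_descentDiagram.2 ⟨⟨?_, fun c hright hleft => ?_⟩, fun v hv => ?_⟩
  · exact (Arc.joinIrr_symm_lt_iff α.lt).2 α.inv_right_left
  · obtain ⟨v, rfl⟩ := α.joinIrr.symm.surjective c
    rcases lt_trichotomy v α.right with hv | rfl | hv
    · obtain ⟨hle, -, -, hnotMem, -⟩ := (Arc.joinIrr_symm_lt_iff hv).1 hright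
      rcases hle.eq_or_lt with rfl | hlt
      · exact hleft.false
      · exact (((Arc.joinIrr_symm_lt_iff hlt).1 hleft).2.2.2.2.resolve_left hnotMem).not_lt hv
    · exact hright.false
    · exact ((Arc.joinIrr_symm_lt_iff (α.lt.trans hv)).1 hleft).2.2.1.not_gt hv
  · obtain ⟨hleft, hright⟩ := mem_Ioo.1 hv
    refine ⟨fun hv => symm_lt_symm_of_not_lt hright.ne fun hlt => ?_, fun hlt => ?_⟩
    · exact ((Arc.joinIrr_symm_lt_iff hright).1 hlt).2.2.2.1 hv
    · by_contra hv
      exact hlt.asymm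
        ((Arc.joinIrr_symm_lt_iff hright).2 ⟨hleft.le, hright, le_rfl, hv, Or.inr rfl⟩)

/-- The permutation obtained from `σ` by exchanging the entries `α.right` and `α.left`; when `α` is
the arc of a descent of `σ`, it is covered by `σ`. -/
def lowerCover (σ : Equiv.Perm (Fin n)) (α : Arc n) : Equiv.Perm (Fin n) :=
  σ.trans (Equiv.swap α.left α.right)

theorem lowerCover_symm_lt_iff (hα : α ∈ descentDiagram σ) (hxy : x < y) :
    (lowerCover σ α).symm y < (lowerCover σ α).symm x ↔
      σ.symm y < σ.symm x ∧ ¬ (x = α.left ∧ y = α.right) := by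
  have hcov : (σ.symm α.right : ℕ) + 1 = σ.symm α.left := by
    simpa only [Fin.covBy_iff, Nat.covBy_iff_add_one_eq] using covBy_of_mem_descentDiagram hα
  have hval : ∀ {u v : Fin n}, (σ.symm u : ℕ) = σ.symm v → u = v := fun h =>
    σ.symm.injective (Fin.ext h)
  have hlt := α.lt
  simp only [lowerCover, Equiv.symm_trans_apply, Equiv.symm_swap, Equiv.swap_apply_def, Fin.lt_def]
    at hxy hlt ⊢
  grind

theorem le_lowerCover_iff (hα : α ∈ descentDiagram σ) :
    τ ≤ lowerCover σ α ↔ τ ≤ σ ∧ ¬ τ.symm α.right < τ.symm α.left := by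
  simp only [weakOrder_le_iff]
  constructor
  · intro h
    refine ⟨fun a b hab hτ => ((lowerCover_symm_lt_iff hα hab).1 (h a b hab hτ)).1, fun hτ => ?_⟩
    exact ((lowerCover_symm_lt_iff hα α.lt).1 (h _ _ α.lt hτ)).2 ⟨rfl, rfl⟩
  · rintro ⟨h, hτ⟩ a b hab hab'
    refine (lowerCover_symm_lt_iff hα hab).2 ⟨h a b hab hab', ?_⟩
    rintro ⟨rfl, rfl⟩
    exact hτ hab'

theorem joinIrr_le_lowerCover_iff (hα : α ∈ descentDiagram σ) :
    β.joinIrr ≤ lowerCover σ α ↔ β.joinIrr ≤ σ ∧ ¬ β.Inv α.right α.left := by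
  rw [le_lowerCover_iff hα, Arc.joinIrr_symm_lt_iff α.lt]

theorem lowerCover_le (hα : α ∈ descentDiagram σ) : lowerCover σ α ≤ σ :=
  ((le_lowerCover_iff hα).1 le_rfl).1

theorem joinIrr_not_le_lowerCover (hα : α ∈ descentDiagram σ) : ¬ α.joinIrr ≤ lowerCover σ α :=
  fun h => ((joinIrr_le_lowerCover_iff hα).1 h).2 α.inv_right_left

theorem joinIrr_le_lowerCover_of_ne (hα : α ∈ descentDiagram σ) (hβ : β ∈ descentDiagram σ)
    (hαβ : α ≠ β) : β.joinIrr ≤ lowerCover σ α :=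
  (joinIrr_le_lowerCover_iff hα).2
    ⟨joinIrr_le_of_mem_descentDiagram hβ, fun h => hαβ (eq_of_inv hα hβ h)⟩

theorem exists_le_lowerCover_of_lt (h : τ < σ) : ∃ α ∈ descentDiagram σ, τ ≤ lowerCover σ α := by
  by_contra! hnot
  refine h.not_ge (le_of_inverts_descents h.le fun α hα => ?_)
  by_contra hτ
  exact hnot α hα ((le_lowerCover_iff hα).2 ⟨h.le, hτ⟩)

theorem lowerCover_sup_eq (hα : α ∈ descentDiagram σ) (hτ : τ ≤ σ) (hτα : ¬ τ ≤ lowerCover σ α) :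
    lowerCover σ α ⊔ τ = σ := by
  by_contra hne
  obtain ⟨β, hβ, hle⟩ :=
    exists_le_lowerCover_of_lt ((sup_le (lowerCover_le hα) hτ).lt_of_ne hne)
  rw [sup_le_iff] at hle
  obtain rfl | hαβ := eq_or_ne α β
  · exact hτα hle.2
  · exact joinIrr_not_le_lowerCover hβ
      ((joinIrr_le_lowerCover_of_ne hα hβ hαβ).trans hle.1)

theorem lowerCover_le_meetIrr (hα : α ∈ descentDiagram σ) : lowerCover σ α ≤ α.meetIrr := by
  refine Arc.le_meetIrr_iff.2 fun y x h => symm_lt_symm_of_not_lt h.lt.ne fun hlt => ?_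
  obtain ⟨hlt, hne⟩ := (lowerCover_symm_lt_iff hα h.lt).1 hlt
  obtain ⟨hx, hy⟩ := h.symm_le hα
  have hcov := covBy_of_mem_descentDiagram hα
  exact hne ⟨σ.symm.injective (hx.antisymm (hcov.ge_of_gt (hy.trans_lt hlt))),
    σ.symm.injective (hy.antisymm' (hcov.le_of_lt (hlt.trans_le hx)))⟩

theorem lowerCover_covBy (hα : α ∈ descentDiagram σ) : lowerCover σ α ⋖ σ := by
  refine ⟨(lowerCover_le hα).lt_of_not_ge fun h => joinIrr_not_le_lowerCover hα
    ((joinIrr_le_of_mem_descentDiagram hα).trans h), fun τ hlt hτ => hτ.ne ?_⟩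
  rw [← lowerCover_sup_eq hα hτ.le hlt.not_ge, sup_eq_right.2 hlt.le]

theorem descentDiagram_joinIrr (α : Arc n) : descentDiagram α.joinIrr = {α} := by
  have hα := mem_descentDiagram_joinIrr α
  refine eq_singleton_iff_unique_mem.2 ⟨hα, fun β hβ => by_contra fun hne => ?_⟩
  exact (lowerCover_covBy hβ).lt.not_ge (joinIrr_le_lowerCover_of_ne hβ hα hne)

theorem existsUnique_covBy_joinIrr (α : Arc n) : ∃! τ, τ ⋖ α.joinIrr := by
  have hα := mem_descentDiagram_joinIrr α
  refine ⟨_, lowerCover_covBy hα, fun τ hτ => ?_⟩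
  obtain ⟨β, hβ, hle⟩ := exists_le_lowerCover_of_lt hτ.lt
  rw [descentDiagram_joinIrr, mem_singleton] at hβ
  subst hβ
  exact (hτ.eq_or_eq hle (lowerCover_le hα)).resolve_right (lowerCover_covBy hα).ne |>.symm

theorem le_of_forall_mem_descentDiagram (h : ∀ α ∈ descentDiagram σ, α.joinIrr ≤ τ) : σ ≤ τ := by
  by_contra hστ
  obtain ⟨α, hα, hle⟩ := exists_le_lowerCover_of_lt (inf_lt_left.2 hστ)
  exact joinIrr_not_le_lowerCover hα
    ((le_inf (joinIrr_le_of_mem_descentDiagram hα) (h α hα)).trans hle)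

theorem sup_joinIrr_descentDiagram (σ : Equiv.Perm (Fin n)) :
    (descentDiagram σ).sup Arc.joinIrr = σ :=
  (Finset.sup_le fun _ => joinIrr_le_of_mem_descentDiagram).antisymm
    (le_of_forall_mem_descentDiagram fun _ => le_sup (f := Arc.joinIrr))

theorem descentDiagram_injective : Function.Injective (descentDiagram (n := n)) := fun σ τ h => by
  rw [← sup_joinIrr_descentDiagram σ, h, sup_joinIrr_descentDiagram]

theorem isNoncrossing_descentDiagram (σ : Equiv.Perm (Fin n)) :
    IsNoncrossing (descentDiagram σ) := by
  intro α hα β hβ hne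
  have hcov := covBy_of_mem_descentDiagram hα
  have hcov' := covBy_of_mem_descentDiagram hβ
  have hends : ¬ (α.left = β.left ∧ α.right = β.right) := fun ⟨hl, hr⟩ =>
    hne (eq_of_inv hα hβ (by simpa only [hl, hr] using β.inv_right_left))
  have hleft : α.left ≠ β.left := fun h =>
    hends ⟨h, σ.symm.injective (hcov.unique_left (h ▸ hcov'))⟩
  have hright : α.right ≠ β.right := fun h =>
    hends ⟨σ.symm.injective (hcov.unique_right (h ▸ hcov')), h⟩
  rw [Arc.cross_iff hleft hright, not_not]
  exact ⟨⟨(joinIrr_le_lowerCover_of_ne hβ hα hne.symm).trans (lowerCover_le_meetIrr hβ),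
    (joinIrr_le_lowerCover_of_ne hα hβ hne).trans (lowerCover_le_meetIrr hα)⟩, hleft, hright⟩

theorem mem_descentDiagram_of_sup_eq (hρ : lowerCover α.joinIrr α ≤ τ) (hτ : τ ≤ α.meetIrr)
    (hσ : τ ⊔ α.joinIrr = σ) : α ∈ descentDiagram σ := by
  have hασ : α.joinIrr ≤ σ := hσ ▸ le_sup_right
  obtain ⟨β, hβ, hle⟩ : ∃ β ∈ descentDiagram σ, τ ≤ lowerCover σ β := by
    refine exists_le_lowerCover_of_lt ((hσ ▸ le_sup_left).lt_of_ne ?_)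
    rintro rfl
    exact α.joinIrr_not_le_meetIrr (hασ.trans hτ)
  have hinv : α.Inv β.right β.left := by
    by_contra h
    refine (lowerCover_covBy hβ).lt.not_ge ?_
    conv_lhs => rw [← hσ]
    exact sup_le hle ((joinIrr_le_lowerCover_iff hβ).2 ⟨hασ, h⟩)
  obtain ⟨hleft, hright⟩ : β.left = α.left ∧ β.right = α.right := by
    by_contra h
    exact ((le_lowerCover_iff hβ).1 (hρ.trans hle)).2
      ((lowerCover_symm_lt_iff (mem_descentDiagram_joinIrr α) β.lt).2
        ⟨(Arc.joinIrr_symm_lt_iff β.lt).2 hinv, h⟩)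
  have hβα := eq_restrict_of_inv hβ hασ hinv
  simp only [hleft, hright, Arc.restrict_self] at hβα
  exact hβα ▸ hβ

theorem descentDiagram_sup_joinIrr {D : Finset (Arc n)} (hD : IsNoncrossing D) :
    descentDiagram (D.sup Arc.joinIrr) = D := by
  have hmeet : ∀ α ∈ D, ∀ β ∈ D, β ≠ α → β.joinIrr ≤ α.meetIrr := fun α hα β hβ hne => by
    obtain ⟨hcross, hleft, hright⟩ := hD β hβ α hα hne
    exact (not_not.1 (mt (Arc.cross_iff hleft hright).2 hcross)).1
  have hsub : D ⊆ descentDiagram (D.sup Arc.joinIrr) := fun α hα => by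
    have hj := mem_descentDiagram_joinIrr α
    refine mem_descentDiagram_of_sup_eq (le_sup_right (a := (D.erase α).sup Arc.joinIrr))
      (sup_le (Finset.sup_le fun β hβ => ?_) (lowerCover_le_meetIrr hj)) ?_
    · exact hmeet α hα β (mem_of_mem_erase hβ) (ne_of_mem_erase hβ)
    · rw [sup_assoc, sup_eq_right.2 (lowerCover_le hj), sup_comm, ← sup_insert, insert_erase hα]
  refine hsub.antisymm' fun β hβ => ?_
  obtain ⟨α, hα, hle⟩ : ∃ α ∈ D, ¬ α.joinIrr ≤ lowerCover (D.sup Arc.joinIrr) β := by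
    by_contra! h
    exact (lowerCover_covBy hβ).lt.not_ge (Finset.sup_le h)
  obtain rfl | hne := eq_or_ne α β
  · exact hα
  · exact absurd (joinIrr_le_lowerCover_of_ne hβ (hsub hα) hne.symm) hle

end Descents

section LatticeCongruences

variable {L : Type*} [Lattice L] {r s : LatticeCon L}

theorem latticeCon_ext (h : ∀ x y, r.r x y ↔ s.r x y) : r = s := by
  obtain ⟨r, hr, hr'⟩ := r
  obtain ⟨s, hs, hs'⟩ := s
  obtain rfl : r = s := Setoid.ext h
  rfl

variable {ι : Type*} {t : Finset ι} {f : ι → L} {x y z : L}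

theorem rel_inf' (ht : t.Nonempty) (h : ∀ i ∈ t, r.r x (f i)) : r.r x (t.inf' ht f) :=
  inf'_induction ht f (fun _ h₁ _ h₂ => by simpa only [inf_idem] using r.inf h₁ h₂) h

theorem rel_sup' (ht : t.Nonempty) (h : ∀ i ∈ t, r.r x (f i)) : r.r x (t.sup' ht f) :=
  sup'_induction ht f (fun _ h₁ _ h₂ => by simpa only [sup_idem] using r.sup h₁ h₂) h

theorem rel_of_mem_Icc (h : r.r x z) (hy : y ∈ Set.Icc x z) : r.r x y := by
  simpa only [inf_eq_left.2 hy.1, inf_eq_right.2 hy.2] using r.inf h (r.refl y)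

theorem exists_setOf_rel_eq_Icc [Finite L] (r : LatticeCon L) (x : L) :
    ∃ a b, a ≤ b ∧ {y | r.r x y} = Set.Icc a b := by
  classical
  have := Fintype.ofFinite L
  have hx : x ∈ univ.filter (r.r x) := mem_filter.2 ⟨mem_univ x, r.refl x⟩
  have hne : (univ.filter (r.r x)).Nonempty := ⟨x, hx⟩
  have ha : r.r x ((univ.filter (r.r x)).inf' hne id) := rel_inf' hne fun _ h => (mem_filter.1 h).2
  have hb : r.r x ((univ.filter (r.r x)).sup' hne id) := rel_sup' hne fun _ h => (mem_filter.1 h).2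
  refine ⟨_, _, (inf'_le id hx).trans (le_sup' id hx),
    Set.ext fun y => ⟨fun hy => ?_, fun hy => ?_⟩⟩
  · have hy : y ∈ univ.filter (r.r x) := mem_filter.2 ⟨mem_univ y, hy⟩
    exact ⟨inf'_le id hy, le_sup' id hy⟩
  · exact r.trans ha (rel_of_mem_Icc (r.trans (r.symm ha) hb) hy)

end LatticeCongruences

section Bottoms

variable {n : ℕ} {r s : LatticeCon (Equiv.Perm (Fin n))} {σ τ : Equiv.Perm (Fin n)} {α : Arc n}

theorem rel_projDown (r : LatticeCon (Equiv.Perm (Fin n))) (σ : Equiv.Perm (Fin n)) :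
    r.r σ (projDown r σ) :=
  rel_inf' _ (by simp)

theorem projDown_le_of_rel (h : r.r σ τ) : projDown r σ ≤ τ :=
  inf'_le id (by simpa using h)

theorem projDown_le (r : LatticeCon (Equiv.Perm (Fin n))) (σ : Equiv.Perm (Fin n)) :
    projDown r σ ≤ σ :=
  projDown_le_of_rel (r.refl σ)

theorem projDown_le_projDown_of_rel (h : r.r σ τ) : projDown r σ ≤ projDown r τ :=
  projDown_le_of_rel (r.trans h (rel_projDown r τ))

theorem projDown_eq_projDown_iff : projDown r σ = projDown r τ ↔ r.r σ τ :=
  ⟨fun h => r.trans (rel_projDown r σ) (h ▸ r.symm (rel_projDown r τ)), fun h =>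
    (projDown_le_projDown_of_rel h).antisymm (projDown_le_projDown_of_rel (r.symm h))⟩

theorem projDown_projDown (r : LatticeCon (Equiv.Perm (Fin n))) (σ : Equiv.Perm (Fin n)) :
    projDown r (projDown r σ) = projDown r σ :=
  projDown_eq_projDown_iff.2 (r.symm (rel_projDown r σ))

theorem projDown_mono (h : σ ≤ τ) : projDown r σ ≤ projDown r τ := by
  have hrel : r.r σ (projDown r τ ⊓ σ) := by
    simpa only [inf_eq_right.2 h] using r.inf (rel_projDown r τ) (r.refl σ)
  exact (projDown_le_of_rel hrel).trans inf_le_left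

theorem mem_uncontractedArcs : α ∈ uncontractedArcs r ↔ projDown r α.joinIrr = α.joinIrr := by
  constructor
  · rintro ⟨σ, -, hσ, hδ⟩
    obtain rfl : σ = α.joinIrr :=
      descentDiagram_injective (hδ.trans (descentDiagram_joinIrr α).symm)
    exact hσ
  · exact fun h => ⟨_, existsUnique_covBy_joinIrr α, h, descentDiagram_joinIrr α⟩

theorem mem_uncontractedArcs_of_projDown_eq_self (hσ : projDown r σ = σ)
    (hα : α ∈ descentDiagram σ) : α ∈ uncontractedArcs r := by
  rw [mem_uncontractedArcs]
  refine (projDown_le r _).eq_of_not_lt fun hlt => ?_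
  obtain ⟨β, hβ, hle⟩ := exists_le_lowerCover_of_lt hlt
  obtain rfl : β = α := mem_singleton.1 (descentDiagram_joinIrr α ▸ hβ)
  have hj := joinIrr_le_of_mem_descentDiagram hα
  have hpσ : projDown r β.joinIrr ≤ lowerCover σ β :=
    (le_lowerCover_iff hα).2 ⟨(projDown_le r _).trans hj, ((le_lowerCover_iff hβ).1 hle).2⟩
  have hrel : r.r σ (lowerCover σ β) := by
    simpa only [lowerCover_sup_eq hα hj (joinIrr_not_le_lowerCover hα), sup_eq_left.2 hpσ]
      using r.sup (r.refl (lowerCover σ β)) (rel_projDown r β.joinIrr)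
  exact (lowerCover_covBy hα).lt.not_ge (hσ.ge.trans (projDown_le_of_rel hrel))

theorem projDown_eq_self_of_subset (h : (descentDiagram σ : Set (Arc n)) ⊆ uncontractedArcs r) :
    projDown r σ = σ := by
  refine (projDown_le r σ).antisymm (le_of_forall_mem_descentDiagram fun α hα => ?_)
  have hrel : r.r α.joinIrr (α.joinIrr ⊓ projDown r σ) := by
    simpa only [inf_eq_left.2 (joinIrr_le_of_mem_descentDiagram hα)]
      using r.inf (r.refl α.joinIrr) (rel_projDown r σ)
  rw [← mem_uncontractedArcs.1 (h hα)]
  exact (projDown_le_of_rel hrel).trans inf_le_right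

theorem projDown_eq_self_iff :
    projDown r σ = σ ↔ (descentDiagram σ : Set (Arc n)) ⊆ uncontractedArcs r :=
  ⟨fun h _ hα => mem_uncontractedArcs_of_projDown_eq_self h hα, projDown_eq_self_of_subset⟩

theorem projDown_le_projDown_of_uncontractedArcs_subset
    (h : uncontractedArcs r ⊆ uncontractedArcs s) (σ : Equiv.Perm (Fin n)) :
    projDown r σ ≤ projDown s σ := by
  have hbot : projDown s (projDown r σ) = projDown r σ :=
    projDown_eq_self_iff.2 ((projDown_eq_self_iff.1 (projDown_projDown r σ)).trans h)
  exact hbot.ge.trans (projDown_mono (projDown_le r σ))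

theorem uncontractedArcs_injective : Function.Injective (uncontractedArcs (n := n)) := by
  intro r s h
  have hproj : projDown r = projDown s := funext fun σ =>
    (projDown_le_projDown_of_uncontractedArcs_subset h.le σ).antisymm
      (projDown_le_projDown_of_uncontractedArcs_subset h.ge σ)
  exact latticeCon_ext fun σ τ => by
    rw [← projDown_eq_projDown_iff, ← projDown_eq_projDown_iff, hproj]

end Bottoms

section ArcIdeals

variable {n : ℕ} {I : ArcIdeal n} {σ τ ρ : Equiv.Perm (Fin n)} {α : Arc n} {D : Finset (Arc n)}

theorem Arc.Noninv.exists_restrict_joinIrr_le {x y : Fin n} (h : α.Noninv y x)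
    (hσ : σ.symm y < σ.symm x) :
    ∃ c b, ∃ hcb : α.Noninv c b, (α.restrict b c hcb.lt).joinIrr ≤ σ := by
  obtain ⟨⟨b, c⟩, ⟨hcb, hσ⟩, hmin⟩ := Set.exists_min_image
    {p : Fin n × Fin n | α.Noninv p.2 p.1 ∧ σ.symm p.2 < σ.symm p.1}
    (fun p => (p.2 : ℕ) - p.1) (Set.toFinite _) ⟨(x, y), h, hσ⟩
  have hshorter : ∀ {u v}, α.Noninv v u → (v : ℕ) - u < c - b → σ.symm u ≤ σ.symm v :=
    fun hvu hlt => not_lt.1 fun hσ => (hmin (_, _) ⟨hvu, hσ⟩).not_gt hlt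
  refine ⟨c, b, hcb, Arc.joinIrr_le_iff.2 fun v u hvu => ?_⟩
  obtain ⟨hbu, huv, hvc, hu, hv⟩ := hvu
  obtain ⟨hleft, _, hright, hb, hc⟩ := hcb
  simp only [Arc.restrict, mem_inter, mem_Ioo] at hbu hvc hu hv
  have hbu' : σ.symm b ≤ σ.symm u := by
    rcases hbu.eq_or_lt with rfl | hbu
    · exact le_rfl
    · refine hshorter ⟨hleft, hbu, (huv.le.trans hvc).trans hright, hb, fun hmem => ?_⟩ (by omega)
      exact hu ⟨hmem, hbu, huv.trans_le hvc⟩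
  have hvc' : σ.symm v ≤ σ.symm c := by
    rcases hv with ⟨hv, -, hvc⟩ | rfl
    · exact hshorter ⟨hleft.trans (hbu.trans huv.le), hvc, hright, Or.inl hv, hc⟩ (by omega)
    · exact le_rfl
  exact hvc'.trans_lt (hσ.trans_le hbu')

theorem Arc.Inv.exists_le_restrict_meetIrr {x y : Fin n} (h : α.Inv y x)
    (hσ : σ.symm x < σ.symm y) :
    ∃ c b, ∃ hcb : α.Inv c b, σ ≤ (α.restrict b c hcb.lt).meetIrr := by
  obtain ⟨⟨b, c⟩, ⟨hcb, hσ⟩, hmin⟩ := Set.exists_min_image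
    {p : Fin n × Fin n | α.Inv p.2 p.1 ∧ σ.symm p.1 < σ.symm p.2}
    (fun p => (p.2 : ℕ) - p.1) (Set.toFinite _) ⟨(x, y), h, hσ⟩
  have hshorter : ∀ {u v}, α.Inv v u → (v : ℕ) - u < c - b → σ.symm v ≤ σ.symm u :=
    fun hvu hlt => not_lt.1 fun hσ => (hmin (_, _) ⟨hvu, hσ⟩).not_gt hlt
  refine ⟨c, b, hcb, Arc.le_meetIrr_iff.2 fun v u hvu => ?_⟩
  obtain ⟨hbu, huv, hvc, hu, hv⟩ := hvu
  obtain ⟨hleft, _, hright, hb, hc⟩ := hcb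
  simp only [Arc.restrict, mem_inter, mem_Ioo] at hbu hvc hu hv
  have hbu' : σ.symm u ≤ σ.symm b := by
    rcases hu with ⟨hu, hbu, -⟩ | rfl
    · exact hshorter ⟨hleft, hbu, (huv.le.trans hvc).trans hright, hb, Or.inl hu⟩ (by omega)
    · exact le_rfl
  have hvc' : σ.symm c ≤ σ.symm v := by
    rcases hvc.eq_or_lt with rfl | hvc
    · exact le_rfl
    · refine hshorter ⟨hleft.trans (hbu.trans huv.le), hvc, hright, fun hmem => ?_, hc⟩ (by omega)
      exact hv ⟨hmem, hbu.trans_lt huv, hvc⟩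
  exact hbu'.trans_lt (hσ.trans_le hvc')

namespace ArcIdeal

/-- The preorder on permutations induced by the arc ideal `I`: the order of the quotient of the weak
order by the lattice congruence of `I`, pulled back to permutations. -/
def Le (I : ArcIdeal n) (σ τ : Equiv.Perm (Fin n)) : Prop :=
  ∀ α ∈ I.carrier, α.joinIrr ≤ σ → α.joinIrr ≤ τ

theorem le_of_le (I : ArcIdeal n) (h : σ ≤ τ) : I.Le σ τ := fun _ _ hα => hα.trans h

theorem Le.trans (h : I.Le σ τ) (h' : I.Le τ ρ) : I.Le σ ρ := fun α hα => h' α hα ∘ h α hα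

theorem le_iff_meetIrr : I.Le σ τ ↔ ∀ α ∈ I.carrier, τ ≤ α.meetIrr → σ ≤ α.meetIrr := by
  refine ⟨fun h α hα hτ => ?_, fun h α hα hσ => ?_⟩
  · refine Arc.le_meetIrr_iff.2 fun y x hyx => symm_lt_symm_of_not_lt hyx.lt.ne fun hσ => ?_
    obtain ⟨c, b, hcb, hle⟩ := hyx.exists_restrict_joinIrr_le hσ
    have hmem := I.restrict_mem α hα b c hcb.lt hcb.1 hcb.2.2.1
    exact ((Arc.joinIrr_le_iff.1 (h _ hmem hle)) c b (Arc.inv_right_left _)).asymm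
      (Arc.le_meetIrr_iff.1 hτ c b hcb)
  · refine Arc.joinIrr_le_iff.2 fun y x hyx => symm_lt_symm_of_not_lt hyx.lt.ne' fun hτ => ?_
    obtain ⟨c, b, hcb, hle⟩ := hyx.exists_le_restrict_meetIrr hτ
    have hmem := I.restrict_mem α hα b c hcb.lt hcb.1 hcb.2.2.1
    exact ((Arc.le_meetIrr_iff.1 (h _ hmem hle)) c b (Arc.noninv_right_left _)).asymm
      (Arc.joinIrr_le_iff.1 hσ c b hcb)

theorem Le.inf {σ' τ' : Equiv.Perm (Fin n)} (h : I.Le σ τ) (h' : I.Le σ' τ') :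
    I.Le (σ ⊓ σ') (τ ⊓ τ') := fun α hα hle =>
  le_inf (h α hα (hle.trans inf_le_left)) (h' α hα (hle.trans inf_le_right))

theorem Le.sup {σ' τ' : Equiv.Perm (Fin n)} (h : I.Le σ τ) (h' : I.Le σ' τ') :
    I.Le (σ ⊔ σ') (τ ⊔ τ') := by
  rw [le_iff_meetIrr] at *
  exact fun α hα hle => sup_le (h α hα (le_sup_left.trans hle)) (h' α hα (le_sup_right.trans hle))

/-- The lattice congruence of the weak order that identifies the permutations lying above the same
join-irreducibles with arcs in `I`. -/
def con (I : ArcIdeal n) : LatticeCon (Equiv.Perm (Fin n)) where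
  r σ τ := I.Le σ τ ∧ I.Le τ σ
  iseqv :=
    { refl := fun _ => ⟨I.le_of_le le_rfl, I.le_of_le le_rfl⟩
      symm := And.symm
      trans := fun h h' => ⟨h.1.trans h'.1, h'.2.trans h.2⟩ }
  inf h h' := ⟨h.1.inf h'.1, h.2.inf h'.2⟩
  sup h h' := ⟨h.1.sup h'.1, h.2.sup h'.2⟩

theorem uncontractedArcs_con (I : ArcIdeal n) : uncontractedArcs I.con = I.carrier := by
  ext α
  rw [mem_uncontractedArcs]
  refine ⟨fun hproj => ?_, fun hα => (projDown_le _ _).antisymm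
    ((rel_projDown I.con α.joinIrr).1 α hα le_rfl)⟩
  by_contra hα
  have hδ := mem_descentDiagram_joinIrr α
  have hrel : I.con.r α.joinIrr (lowerCover α.joinIrr α) := by
    refine ⟨fun β hβ hle => (joinIrr_le_lowerCover_iff hδ).2 ⟨hle, fun hinv => hα ?_⟩,
      I.le_of_le (lowerCover_le hδ)⟩
    rw [eq_restrict_of_inv hδ hle hinv]
    exact I.restrict_mem β hβ _ _ _ hinv.1 hinv.2.2.1
  exact (lowerCover_covBy hδ).lt.not_ge (hproj.ge.trans (projDown_le_of_rel hrel))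

theorem arcCongruence_eq_con (I : ArcIdeal n) : arcCongruence I = I.con := by
  refine latticeCon_ext fun σ τ => ⟨fun h => h I.con I.uncontractedArcs_con, fun h r hr => ?_⟩
  rwa [uncontractedArcs_injective (hr.trans I.uncontractedArcs_con.symm)]

end ArcIdeal

theorem eta_eq_eta_iff : eta I σ = eta I τ ↔ I.Le σ τ ∧ I.Le τ σ := by
  rw [eta, eta, descentDiagram_injective.eq_iff, projDown_eq_projDown_iff, I.arcCongruence_eq_con]
  rfl

theorem eta_eq_of_le_of_le (h : eta I σ = eta I ρ) (hσ : I.Le σ τ) (hρ : I.Le τ ρ) :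
    eta I τ = eta I σ :=
  eta_eq_eta_iff.2 ⟨hρ.trans (eta_eq_eta_iff.1 h).2, hσ⟩

theorem isNoncrossing_eta (I : ArcIdeal n) (σ : Equiv.Perm (Fin n)) : IsNoncrossing (eta I σ) :=
  isNoncrossing_descentDiagram _

theorem eta_subset (I : ArcIdeal n) (σ : Equiv.Perm (Fin n)) :
    (eta I σ : Set (Arc n)) ⊆ I.carrier := by
  rw [← I.uncontractedArcs_con, ← I.arcCongruence_eq_con]
  exact projDown_eq_self_iff.1 (projDown_projDown _ σ)

theorem eta_sup_joinIrr (hD : IsNoncrossing D) (hDI : (D : Set (Arc n)) ⊆ I.carrier) :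
    eta I (D.sup Arc.joinIrr) = D := by
  rw [eta, projDown_eq_self_of_subset, descentDiagram_sup_joinIrr hD]
  rwa [descentDiagram_sup_joinIrr hD, I.arcCongruence_eq_con, I.uncontractedArcs_con]

theorem diagramLE_eta_iff : DiagramLE I (eta I σ) (eta I τ) ↔ I.Le σ τ := by
  constructor
  · rintro ⟨σ', τ', hσ, hτ, hle⟩
    exact ((eta_eq_eta_iff.1 hσ).2.trans (I.le_of_le hle)).trans (eta_eq_eta_iff.1 hτ).1
  · refine fun h => ⟨σ ⊓ τ, τ, eta_eq_eta_iff.2 ⟨I.le_of_le inf_le_left, fun α hα hle => ?_⟩, rfl,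
      inf_le_right⟩
    exact le_inf hle (h α hα hle)

theorem exists_setOf_eta_eq_Icc (hD : IsNoncrossing D) (hDI : (D : Set (Arc n)) ⊆ I.carrier) :
    ∃ μ ν, μ ≤ ν ∧ {σ | eta I σ = D} = Set.Icc μ ν := by
  obtain ⟨μ, ν, hle, hIcc⟩ := exists_setOf_rel_eq_Icc I.con (D.sup Arc.joinIrr)
  refine ⟨μ, ν, hle, hIcc ▸ Set.ext fun σ => ?_⟩
  change eta I σ = D ↔ I.con.r (D.sup Arc.joinIrr) σ
  conv_lhs => rw [← eta_sup_joinIrr hD hDI, eq_comm, eta_eq_eta_iff]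
  rfl

end ArcIdeals

section Concatenation

variable {m n : ℕ} {σ : Equiv.Perm (Fin m)} {τ : Equiv.Perm (Fin n)}
  {ρ ρ' : Equiv.Perm (Fin (m + n))}

theorem castAdd_lt_natAdd (a : Fin m) (b : Fin n) : Fin.castAdd n a < Fin.natAdd m b :=
  Fin.lt_def.2 (a.isLt.trans_le (Nat.le_add_right m b))

theorem backslash_symm_castAdd (a : Fin m) :
    (backslash σ τ).symm (Fin.castAdd n a) = Fin.castAdd n (σ.symm a) := by
  simp [backslash]

theorem backslash_symm_natAdd (b : Fin n) :
    (backslash σ τ).symm (Fin.natAdd m b) = Fin.natAdd m (τ.symm b) := by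
  simp [backslash]

theorem coe_slash_symm_castAdd (a : Fin m) :
    ((slash τ σ).symm (Fin.castAdd n a) : ℕ) = n + σ.symm a := by
  simp [slash, add_comm]

theorem coe_slash_symm_natAdd (b : Fin n) :
    ((slash τ σ).symm (Fin.natAdd m b) : ℕ) = τ.symm b := by
  simp [slash]

theorem stdVal_symm_lt_iff {p q : ℕ} {ρ : Equiv.Perm (Fin p)} {R : Finset (Fin p)}
    (hR : R.card = q) {a b : Fin q} :
    (stdVal ρ R hR).symm a < (stdVal ρ R hR).symm b ↔
      ρ.symm (R.orderEmbOfFin hR a) < ρ.symm (R.orderEmbOfFin hR b) := by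
  have symm_apply : ∀ c : Fin q, (stdVal ρ R hR).symm c =
      ((R.map ρ.symm.toEmbedding).orderIsoOfFin ((card_map _).trans hR)).symm
        ⟨ρ.symm (R.orderEmbOfFin hR c), by simp⟩ := fun _ => rfl
  rw [symm_apply, symm_apply, OrderIso.lt_iff_lt]
  exact Iff.rfl

/-- The subword of `ρ` on the values of `[m]`. -/
def lowPart (ρ : Equiv.Perm (Fin (m + n))) : Equiv.Perm (Fin m) :=
  stdVal ρ (univ.map (Fin.castAddEmb n)) (by simp)

/-- The standardization of the subword of `ρ` on the values of `[m + n] \ [m]`. -/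
def highPart (ρ : Equiv.Perm (Fin (m + n))) : Equiv.Perm (Fin n) :=
  stdVal ρ (univ.map (Fin.natAddEmb m)) (by simp)

theorem lowPart_symm_lt_iff {a b : Fin m} : (lowPart ρ).symm a < (lowPart ρ).symm b ↔
    ρ.symm (Fin.castAdd n a) < ρ.symm (Fin.castAdd n b) := by
  rw [lowPart, stdVal_symm_lt_iff,
    ← orderEmbOfFin_unique _ (f := Fin.castAdd n) (by simp) (Fin.strictMono_castAdd n)]

theorem highPart_symm_lt_iff {a b : Fin n} : (highPart ρ).symm a < (highPart ρ).symm b ↔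
    ρ.symm (Fin.natAdd m a) < ρ.symm (Fin.natAdd m b) := by
  rw [highPart, stdVal_symm_lt_iff,
    ← orderEmbOfFin_unique _ (f := Fin.natAdd m) (by simp) (Fin.strictMono_natAdd m)]

theorem backslash_le_iff : backslash σ τ ≤ ρ ↔ σ ≤ lowPart ρ ∧ τ ≤ highPart ρ := by
  simp only [weakOrder_le_iff, lowPart_symm_lt_iff, highPart_symm_lt_iff, Fin.forall_fin_add,
    backslash_symm_castAdd, backslash_symm_natAdd, (Fin.strictMono_castAdd n).lt_iff_lt,
    (Fin.strictMono_natAdd m).lt_iff_lt, castAdd_lt_natAdd, (castAdd_lt_natAdd _ _).not_gt]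
  simp

theorem le_slash_iff : ρ ≤ slash τ σ ↔ lowPart ρ ≤ σ ∧ highPart ρ ≤ τ := by
  have low_after_high (a : Fin m) (b : Fin n) : (τ.symm b : ℕ) < n + σ.symm a :=
    (τ.symm b).isLt.trans_le (Nat.le_add_right n _)
  simp only [weakOrder_le_iff, lowPart_symm_lt_iff, highPart_symm_lt_iff, Fin.forall_fin_add,
    (Fin.strictMono_castAdd n).lt_iff_lt, (Fin.strictMono_natAdd m).lt_iff_lt,
    Fin.lt_def (a := (slash τ σ).symm _), coe_slash_symm_castAdd, coe_slash_symm_natAdd,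
    Nat.add_lt_add_iff_left, (castAdd_lt_natAdd _ _).not_gt, low_after_high]
  simp

theorem Arc.inv_augment_iff {α : Arc m} {y x : Fin (m + n)} : (α.augment n).Inv y x ↔
    ∃ b a, α.Inv b a ∧ Fin.castAdd n b = y ∧ Fin.castAdd n a = x := by
  induction x using Fin.addCases <;> induction y using Fin.addCases <;>
    simp [Inv, augment, (castAdd_lt_natAdd _ _).not_ge, (castAdd_lt_natAdd _ _).not_gt,
      (castAdd_lt_natAdd _ _).ne, (Fin.strictMono_castAdd n).le_iff_le,
      (Fin.strictMono_castAdd n).lt_iff_lt]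

theorem Arc.inv_shift_iff {α : Arc n} {y x : Fin (m + n)} : (α.shift m).Inv y x ↔
    ∃ b a, α.Inv b a ∧ Fin.natAdd m b = y ∧ Fin.natAdd m a = x := by
  induction x using Fin.addCases <;> induction y using Fin.addCases <;>
    simp [Inv, shift, (castAdd_lt_natAdd _ _).not_ge, (castAdd_lt_natAdd _ _).not_gt,
      (castAdd_lt_natAdd _ _).ne']

theorem joinIrr_augment_le_iff {α : Arc m} :
    (α.augment n).joinIrr ≤ ρ ↔ α.joinIrr ≤ lowPart ρ := by
  simp only [Arc.joinIrr_le_iff, Arc.inv_augment_iff, lowPart_symm_lt_iff]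
  exact ⟨fun h b a hba => h _ _ ⟨b, a, hba, rfl, rfl⟩,
    fun h _ _ ⟨b, a, hba, hy, hx⟩ => hy ▸ hx ▸ h b a hba⟩

theorem joinIrr_shift_le_iff {α : Arc n} :
    (α.shift m).joinIrr ≤ ρ ↔ α.joinIrr ≤ highPart ρ := by
  simp only [Arc.joinIrr_le_iff, Arc.inv_shift_iff, highPart_symm_lt_iff]
  exact ⟨fun h b a hba => h _ _ ⟨b, a, hba, rfl, rfl⟩,
    fun h _ _ ⟨b, a, hba, hy, hx⟩ => hy ▸ hx ▸ h b a hba⟩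

variable {I : ArcIdeal m} {J : ArcIdeal n} {K : ArcIdeal (m + n)}

theorem ArcIdeal.Le.lowPart (hIK : ∀ α ∈ I.carrier, α.augment n ∈ K.carrier) (h : K.Le ρ ρ') :
    I.Le (lowPart ρ) (lowPart ρ') := fun α hα hle =>
  joinIrr_augment_le_iff.1 (h _ (hIK α hα) (joinIrr_augment_le_iff.2 hle))

theorem ArcIdeal.Le.highPart (hJK : ∀ α ∈ J.carrier, α.shift m ∈ K.carrier) (h : K.Le ρ ρ') :
    J.Le (highPart ρ) (highPart ρ') := fun α hα hle =>
  joinIrr_shift_le_iff.1 (h _ (hJK α hα) (joinIrr_shift_le_iff.2 hle))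

theorem ArcIdeal.le_lowPart_highPart (hIK : ∀ α ∈ I.carrier, α.augment n ∈ K.carrier)
    (hJK : ∀ α ∈ J.carrier, α.shift m ∈ K.carrier) (h : K.Le (backslash σ τ) ρ) :
    I.Le σ (lowPart ρ) ∧ J.Le τ (highPart ρ) :=
  have hle := backslash_le_iff.1 (le_refl (backslash σ τ))
  ⟨(I.le_of_le hle.1).trans (h.lowPart hIK), (J.le_of_le hle.2).trans (h.highPart hJK)⟩

theorem ArcIdeal.lowPart_highPart_le (hIK : ∀ α ∈ I.carrier, α.augment n ∈ K.carrier)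
    (hJK : ∀ α ∈ J.carrier, α.shift m ∈ K.carrier) (h : K.Le ρ (slash τ σ)) :
    I.Le (lowPart ρ) σ ∧ J.Le (highPart ρ) τ :=
  have hle := le_slash_iff.1 (le_refl (slash τ σ))
  ⟨(h.lowPart hIK).trans (I.le_of_le hle.1), (h.highPart hJK).trans (J.le_of_le hle.2)⟩

theorem eta_mem_diagramInterval_iff (hIK : ∀ α ∈ I.carrier, α.augment n ∈ K.carrier)
    (hJK : ∀ α ∈ J.carrier, α.shift m ∈ K.carrier) {D : Finset (Arc m)} {E : Finset (Arc n)}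
    {μ ν : Equiv.Perm (Fin m)} {lam ω : Equiv.Perm (Fin n)}
    (hμν : μ ≤ ν) (hD : {σ | eta I σ = D} = Set.Icc μ ν)
    (hlamω : lam ≤ ω) (hE : {τ | eta J τ = E} = Set.Icc lam ω) :
    eta K ρ ∈ diagramInterval K (eta K (backslash μ lam)) (eta K (slash ω ν)) ↔
      eta I (lowPart ρ) = D ∧ eta J (highPart ρ) = E := by
  have mem_D (σ) : eta I σ = D ↔ μ ≤ σ ∧ σ ≤ ν := Set.ext_iff.1 hD σ
  have mem_E (τ) : eta J τ = E ↔ lam ≤ τ ∧ τ ≤ ω := Set.ext_iff.1 hE τ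
  have mem_interval : eta K ρ ∈ diagramInterval K (eta K (backslash μ lam)) (eta K (slash ω ν)) ↔
      K.Le (backslash μ lam) ρ ∧ K.Le ρ (slash ω ν) := by
    simp [diagramInterval, isNoncrossing_eta, eta_subset, diagramLE_eta_iff]
  rw [mem_interval]
  constructor
  · rintro ⟨hlow, hup⟩
    obtain ⟨hμ, hlam⟩ := ArcIdeal.le_lowPart_highPart hIK hJK hlow
    obtain ⟨hν, hω⟩ := ArcIdeal.lowPart_highPart_le hIK hJK hup
    have hDμ := (mem_D μ).2 ⟨le_rfl, hμν⟩
    have hElam := (mem_E lam).2 ⟨le_rfl, hlamω⟩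
    exact ⟨(eta_eq_of_le_of_le (hDμ.trans ((mem_D ν).2 ⟨hμν, le_rfl⟩).symm) hμ hν).trans hDμ,
      (eta_eq_of_le_of_le (hElam.trans ((mem_E ω).2 ⟨hlamω, le_rfl⟩).symm) hlam hω).trans hElam⟩
  · rw [mem_D, mem_E]
    rintro ⟨⟨hμ, hν⟩, hlam, hω⟩
    exact ⟨K.le_of_le (backslash_le_iff.2 ⟨hμ, hlam⟩), K.le_of_le (le_slash_iff.2 ⟨hν, hω⟩)⟩

end Concatenation

section Algebra

variable {k : Type v} [Field k] {𝔛 : DecorationSet.{u}} {m n : ℕ} {X : 𝔛.carrier m}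
  {Y : 𝔛.carrier n}

theorem product_basisF {σ : Equiv.Perm (Fin m)} {τ : Equiv.Perm (Fin n)} :
    product k 𝔛 (basisF k 𝔛 σ X) (basisF k 𝔛 τ Y) =
      ∑ ρ with lowPart ρ = σ ∧ highPart ρ = τ, basisF k 𝔛 ρ (𝔛.concat X Y) := by
  simp only [product, basisF, Finsupp.linearCombination_single, one_smul]
  rfl

variable {A : ConservativeFunction 𝔛}

theorem product_basisP {D : Finset (Arc m)} {E : Finset (Arc n)} :
    product k 𝔛 (basisP k A D X) (basisP k A E Y) =
      ∑ ρ with eta (A.arcs X) (lowPart ρ) = D ∧ eta (A.arcs Y) (highPart ρ) = E,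
        basisF k 𝔛 ρ (𝔛.concat X Y) := by
  classical
  let s := ({σ | eta (A.arcs X) σ = D} : Finset (Equiv.Perm (Fin m))) ×ˢ
    ({τ | eta (A.arcs Y) τ = E} : Finset (Equiv.Perm (Fin n)))
  calc
    product k 𝔛 (basisP k A D X) (basisP k A E Y) =
        ∑ p ∈ s, ∑ ρ with (lowPart ρ, highPart ρ) = p, basisF k 𝔛 ρ (𝔛.concat X Y) := by
      simp only [basisP, map_sum, LinearMap.sum_apply, product_basisF, s, sum_product_right,
        Prod.mk.injEq]
    _ = ∑ ρ with (lowPart ρ, highPart ρ) ∈ s, basisF k 𝔛 ρ (𝔛.concat X Y) :=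
      sum_fiberwise_eq_sum_filter _ _ _ _
    _ = _ := by simp [s]

theorem sum_basisP (t : Finset (Finset (Arc m))) :
    ∑ F ∈ t, basisP k A F X = ∑ σ with eta (A.arcs X) σ ∈ t, basisF k 𝔛 σ X :=
  sum_fiberwise_eq_sum_filter _ _ _ _

end Algebra

end ArcHopf

theorem mainTheorem4 {k : Type v} [Field k] (𝔛 : ArcHopf.DecorationSet.{u})
    (A : ArcHopf.ConservativeFunction 𝔛) {m n : ℕ}
    (X : 𝔛.carrier m) (Y : 𝔛.carrier n)
    (D : Finset (ArcHopf.Arc m)) (E : Finset (ArcHopf.Arc n))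
    (hD : ArcHopf.IsNoncrossing D) (hDX : (D : Set (ArcHopf.Arc m)) ⊆ (A.arcs X).carrier)
    (hE : ArcHopf.IsNoncrossing E) (hEY : (E : Set (ArcHopf.Arc n)) ⊆ (A.arcs Y).carrier) :
    ∃ (μ ν : Equiv.Perm (Fin m)) (lam ω : Equiv.Perm (Fin n)),
      μ ≤ ν ∧ {σ | ArcHopf.eta (A.arcs X) σ = D} = Set.Icc μ ν ∧
      lam ≤ ω ∧ {τ | ArcHopf.eta (A.arcs Y) τ = E} = Set.Icc lam ω ∧
      ArcHopf.product k 𝔛 (ArcHopf.basisP k A D X) (ArcHopf.basisP k A E Y) =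
        ∑ F ∈ ArcHopf.diagramInterval (A.arcs (𝔛.concat X Y))
            (ArcHopf.eta (A.arcs (𝔛.concat X Y)) (ArcHopf.backslash μ lam))
            (ArcHopf.eta (A.arcs (𝔛.concat X Y)) (ArcHopf.slash ω ν)),
          ArcHopf.basisP k A F (𝔛.concat X Y) := by
  obtain ⟨μ, ν, hμν, hfiberD⟩ := ArcHopf.exists_setOf_eta_eq_Icc hD hDX
  obtain ⟨lam, ω, hlamω, hfiberE⟩ := ArcHopf.exists_setOf_eta_eq_Icc hE hEY
  refine ⟨μ, ν, lam, ω, hμν, hfiberD, hlamω, hfiberE, ?_⟩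
  simp only [ArcHopf.product_basisP, ArcHopf.sum_basisP, ArcHopf.eta_mem_diagramInterval_iff
    (A.augment_mem X Y) (A.shift_mem X Y) hμν hfiberD hlamω hfiberE]
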